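/- **Theorem 2.4.** Let $\{P_\zeta:\zeta\in\mathbb R\}$ be transition matrices on ${\sf X}=\{1,\dots,d\}$ satisfying **A1:** $P_0$ is irreducible and aperiodic, and $\zeta\mapsto P_\zeta$ is $C^2$ in a neighborhood of $0$ with Lipschitz continuous second derivative there. Let $\pi_0$ be the invariant pmf (row vector) of $P_0$, $\Pi_0=\mathrm{diag}(\pi_0)$, $A=P_0^T$, ${\cal E}=\frac{d}{d\zeta}P_\zeta|_{\zeta=0}$, ${\cal W}=\frac{d^2}{d\zeta^2}P_\zeta|_{\zeta=0}$, $B^T=\pi_0{\cal E}$ and $\Sigma^{\Delta^\bullet}=\Pi_0-P_0^T\Pi_0P_0$. Let the disturbance satisfy **A2:** $\zeta_t=\varepsilon\zeta^1_t$, $t\in\mathbb Z$, where $\zeta^1$ is a real stationary process with zero mean, $|\zeta^1_t|\le 1$ almost surely, and $\sum_{t\ge0}|R_{\zeta^1}(t)|<\infty$; here $R_{\zeta^1}(t)={\sf E}[\zeta^1_t\zeta^1_0]$, $R_\zeta(t)={\sf E}[\zeta_t\zeta_0]$ and $\sigma_\zeta^2={\sf E}[\zeta_0^2]$. Consider any process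 $\Gamma$ on $\mathbb Z$ with values in the standard basis $\{e^1,\dots,e^d\}$ of row vectors, jointly stationary with $\zeta$, such that $\Gamma_{t+1}=\Gamma_tG_{t+1}$, $G_{t+1}={\cal G}(\zeta_t,N_{t+1})$, where ${\cal G}$ is a measurable $0$–$1$ matrix-valued function whose rows sum to one, $N$ is i.i.d. and independent of $\zeta$, $N_{t+1}$ is independent of $\zeta$ jointly with $(\Gamma_s,N_s)_{s\le t}$, and ${\sf E}[{\cal G}(\zeta_t,N_{t+1})\mid\zeta]=P_{\zeta_t}$. (In particular, $\Gamma$ may be the first component of a stationary process $(\Gamma,\Gamma^\bullet,\zeta)$ in which $\Gamma$ is coupled with a stationary chain $\Gamma^\bullet$ with transition matrix $P_0$ that is independent of $\zeta$.) Put $$\Delta_{t+1}=\Gamma_t(G_{t+1}-P_{\zeta_t}),\quad B_t^T=\Gamma_t{\cal E},\quad V_t^T=\tfrac12\Gamma_t{\cal W},\quad D_{t+1}=B_t^T\zeta_t+V_t^T\zeta_t^2+\Delta_{t+1},$$ $\pi_\varepsilon={\sf E}[\Gamma_t]$, $\Pi_\varepsilon=\mathrm{diag}(\pi_\varepsilon)$,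 and $$R_D(t)={\sf E}[D_t^TD_0],\quad R_{D,\zeta}(t)={\sf E}[D_t^T\zeta_0],\quad R_{\Gamma,\zeta}(t)={\sf E}[\Gamma_t^T\zeta_0],\quad R_{B\zeta}(t)={\sf E}[B_t\zeta_tB_0^T\zeta_0],$$ $$R_\Delta(t)={\sf E}[\Delta_t^T\Delta_0],\quad R_{B\zeta,\Delta}(t)={\sf E}[B_t\zeta_t\Delta_0],\quad R_{V\zeta^2,\Delta}(t)={\sf E}[V_t\zeta_t^2\Delta_0],\quad R_{\Delta^2,\zeta}(t)={\sf E}[\Delta_t^T\Delta_t\zeta_0].$$ Then there are $\varepsilon_0>0$ and $C<\infty$, depending only on $\{P_\zeta\}$, such that for all $\varepsilon\in(0,\varepsilon_0]$ the following hold, where each $O(\varepsilon^3)$ is a term whose entries are at most $C\varepsilon^3$ in absolute value, uniformly in $t$. For all $t\in\mathbb Z$, $$R_{D,\zeta}(t)=B\,R_\zeta(t-1)+O(\varepsilon^3),$$ $$R_D(t)=R_{B\zeta}(t)+R_\Delta(t)+\bigl[R_{B\zeta,\Delta}(t-1)+R_{B\zeta,\Delta}^T(-t-1)\bigr]+\bigl[R_{V\zeta^2,\Delta}(t-1)+R_{V\zeta^2,\Delta}^T(-t-1)\bigr]+O(\varepsilon^3).$$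 Moreover: (a) $R_{B\zeta}(t)=(P_0^t{\cal E})^T\Pi_0{\cal E}\,R_\zeta(t)+O(\varepsilon^3)$ for $t\ge0$. (b) $R_\Delta(t)=0$ for $t\ne0$, and $$R_\Delta(0)=\Pi_\varepsilon-P_0^T\Pi_\varepsilon P_0-\bigl[P_0^T\mathrm{diag}(R_{\Gamma,\zeta}(0)){\cal E}+{\cal E}^T\mathrm{diag}(R_{\Gamma,\zeta}(0))P_0\bigr]-\tfrac12R_\zeta(0)\bigl[P_0^T\Pi_0{\cal W}+2{\cal E}^T\Pi_0{\cal E}+{\cal W}^T\Pi_0P_0\bigr]+O(\varepsilon^3).$$ In the case $\varepsilon=0$, that is, for any such stationary process with $\zeta\equiv0$, one has exactly $R_\Delta(0)=\Sigma^{\Delta^\bullet}$. (c) $R_{B\zeta,\Delta}(t)=0$ for $t<0$; $R_{B\zeta,\Delta}(0)={\cal E}^TR_{\Delta^2,\zeta}(0)+O(\varepsilon^3)$; and for $t\ge1$ $$R_{B\zeta,\Delta}(t)={\cal E}^TA^tR_{\Delta^2,\zeta}(-t)+{\cal E}^T\sum_{i=0}^{t-1}A^{t-1-i}{\cal E}^TA^iR_\zeta(t-i)\,\Sigma^{\Delta^\bullet}+O(\varepsilon^3).$$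 (d) $R_{V\zeta^2,\Delta}(t)=0$ for $t<0$, and $R_{V\zeta^2,\Delta}(t)=\tfrac12\sigma_\zeta^2(P_0^t{\cal W})^T\Sigma^{\Delta^\bullet}+O(\varepsilon^3)$ for $t\ge0$. -/

import Mathlib

open MeasureTheory ProbabilityTheory Matrix

namespace PerturbedChain

noncomputable section

/-- Aperiodicity of a transition matrix: for every state `i`, the greatest common divisor of
`{n ≥ 1 : (Q ^ n) i i > 0}` is one. -/
def Aperiodic {d : ℕ} (Q : Matrix (Fin d) (Fin d) ℝ) : Prop :=
  ∀ i : Fin d, ∀ k : ℕ, (∀ n : ℕ, 1 ≤ n → 0 < (Q ^ n) i i → k ∣ n) → k = 1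

/-- The invariant probability mass function of a transition matrix (as a row vector). -/
def IsInvariantPmf {d : ℕ} (Q : Matrix (Fin d) (Fin d) ℝ) (p : Fin d → ℝ) : Prop :=
  (∀ i, 0 ≤ p i) ∧ ∑ i, p i = 1 ∧ p ᵥ* Q = p

/-- Assumption A1 on the controlled transition matrix `P`, together with the standing requirement
that every `P z` is a transition matrix.  The matrix-valued function `P` is of class `C²`
near zero, with Lipschitz continuous second derivative there (entry by entry). -/
structure AssumptionA1 {d : ℕ} (P : ℝ → Matrix (Fin d) (Fin d) ℝ) : Prop where
  stochastic : ∀ z, P z ∈ Matrix.rowStochastic ℝ (Fin d)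
  irreducible : (P 0).IsIrreducible
  aperiodic : Aperiodic (P 0)
  smooth : ∃ δ > (0 : ℝ), ∃ L : NNReal, ∀ i j,
    ContDiffOn ℝ 2 (fun z => P z i j) (Set.Ioo (-δ) δ) ∧
    LipschitzOnWith L (iteratedDeriv 2 (fun z => P z i j)) (Set.Ioo (-δ) δ)

/-- The first derivative of `P` at zero. -/
def firstDeriv {d : ℕ} (P : ℝ → Matrix (Fin d) (Fin d) ℝ) : Matrix (Fin d) (Fin d) ℝ :=
  Matrix.of fun i j => deriv (fun z => P z i j) 0

/-- The second derivative of `P` at zero. -/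
def secondDeriv {d : ℕ} (P : ℝ → Matrix (Fin d) (Fin d) ℝ) : Matrix (Fin d) (Fin d) ℝ :=
  Matrix.of fun i j => iteratedDeriv 2 (fun z => P z i j) 0

section Proc

variable {Ω : Type*} [MeasurableSpace Ω]

/-- Strict stationarity of a two-sided process: its law on path space is shift invariant. -/
def Stationary {S : Type*} [MeasurableSpace S] (μ : Measure Ω) (Y : ℤ → Ω → S) : Prop :=
  ∀ k : ℤ, μ.map (fun ω (t : ℤ) => Y (t + k) ω) = μ.map (fun ω (t : ℤ) => Y t ω)

/-- The auto-correlation `R_ζ(t) = E[ζ_t ζ_0]` of a scalar process. -/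
def autoCorr (μ : Measure Ω) (ζ : ℤ → Ω → ℝ) (t : ℤ) : ℝ := ∫ ω, ζ t ω * ζ 0 ω ∂μ

/-- Assumption A2 on the normalised disturbance. -/
structure AssumptionA2 (μ : Measure Ω) (ζ₁ : ℤ → Ω → ℝ) : Prop where
  measurable : ∀ t, Measurable (ζ₁ t)
  stationary : Stationary μ ζ₁
  zero_mean : ∀ t, ∫ ω, ζ₁ t ω ∂μ = 0
  bounded : ∀ t, ∀ᵐ ω ∂μ, |ζ₁ t ω| ≤ 1
  summable : Summable fun t : ℕ => |autoCorr μ ζ₁ t|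

/-- The σ-algebra generated by a whole process. -/
abbrev procSigma {S : Type*} [MeasurableSpace S] (Y : ℤ → Ω → S) : MeasurableSpace Ω :=
  ⨆ s : ℤ, MeasurableSpace.comap (Y s) inferInstance

/-- The σ-algebra generated by a process up to and including time `t`. -/
abbrev pastSigma {S : Type*} [MeasurableSpace S] (Y : ℤ → Ω → S) (t : ℤ) : MeasurableSpace Ω :=
  ⨆ s : ℤ, ⨆ _ : s ≤ t, MeasurableSpace.comap (Y s) inferInstance

/-- The matrix `E[uᵀ v]` for random row vectors `u`, `v`. -/
def crossMoment {d : ℕ} (μ : Measure Ω) (u v : Ω → Fin d → ℝ) : Matrix (Fin d) (Fin d) ℝ :=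
  Matrix.of fun i j => ∫ ω, u ω i * v ω j ∂μ

/-- A stationary solution, on the two-sided time axis, of the random linear system
`Γ_{t+1} = Γ_t G_{t+1}`, `G_{t+1} = 𝒢(ζ_t, N_{t+1})`, where `Γ_t` is the standard basis vector
indexed by `X_t`.

* `𝒢` has entries zero or one and each of its rows sums to one;
* `N` is i.i.d., independent of the whole process `ζ`, and the solution is causal: `N_{t+1}` is
  independent of `ζ` together with `(X_s, N_s)`, `s ≤ t`.  (By induction on the number of time
  points, `causal` implies that `N` is an independent sequence which is independent of `ζ`.)
* `E[𝒢(ζ_t, N_{t+1}) ∣ ζ] = P_{ζ_t}`;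
* `(X, ζ)` is jointly stationary. -/
structure StationarySolution {d : ℕ} (P : ℝ → Matrix (Fin d) (Fin d) ℝ) (μ : Measure Ω)
    (ζ : ℤ → Ω → ℝ) (𝒩 : Type*) [MeasurableSpace 𝒩] where
  𝒢 : ℝ → 𝒩 → Matrix (Fin d) (Fin d) ℝ
  N : ℤ → Ω → 𝒩
  X : ℤ → Ω → Fin d
  measurable_𝒢 : ∀ i j, Measurable fun p : ℝ × 𝒩 => 𝒢 p.1 p.2 i j
  measurable_N : ∀ t, Measurable (N t)
  measurable_X : ∀ t, Measurable (X t)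
  zero_or_one : ∀ z n i j, 𝒢 z n i j = 0 ∨ 𝒢 z n i j = 1
  row_sum : ∀ z n i, ∑ j, 𝒢 z n i j = 1
  ident : ∀ t, μ.map (N t) = μ.map (N 0)
  causal : ∀ t, Indep (MeasurableSpace.comap (N (t + 1)) inferInstance)
    (procSigma ζ ⊔ pastSigma X t ⊔ pastSigma N t) μ
  transition : ∀ t i j,
    μ[fun ω => 𝒢 (ζ t ω) (N (t + 1) ω) i j | procSigma ζ] =ᵐ[μ] fun ω => P (ζ t ω) i j
  dynamics : ∀ t, ∀ᵐ ω ∂μ, (Pi.single (X (t + 1) ω) 1 : Fin d → ℝ) =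
    (Pi.single (X t ω) 1 : Fin d → ℝ) ᵥ* 𝒢 (ζ t ω) (N (t + 1) ω)
  stationary : Stationary μ (fun t ω => (X t ω, ζ t ω))

namespace StationarySolution

variable {d : ℕ} {P : ℝ → Matrix (Fin d) (Fin d) ℝ} {μ : Measure Ω} {ζ : ℤ → Ω → ℝ}
  {𝒩 : Type*} [MeasurableSpace 𝒩] (S : StationarySolution P μ ζ 𝒩)

/-- The indicator process `Γ_t` (row vector). -/
def Γ (t : ℤ) (ω : Ω) : Fin d → ℝ := Pi.single (S.X t ω) 1

/-- `Δ_{t+1} = Γ_t (G_{t+1} - P_{ζ_t})`. -/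
def Δ (t : ℤ) (ω : Ω) : Fin d → ℝ :=
  S.Γ (t - 1) ω ᵥ* (S.𝒢 (ζ (t - 1) ω) (S.N t ω) - P (ζ (t - 1) ω))

/-- `B_tᵀ = Γ_t ℰ`. -/
def B (t : ℤ) (ω : Ω) : Fin d → ℝ := S.Γ t ω ᵥ* firstDeriv P

/-- `V_tᵀ = ½ Γ_t 𝒲`. -/
def V (t : ℤ) (ω : Ω) : Fin d → ℝ := (1 / 2 : ℝ) • (S.Γ t ω ᵥ* secondDeriv P)

/-- `D_{t+1} = B_tᵀ ζ_t + V_tᵀ ζ_t² + Δ_{t+1}`. -/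
def D (t : ℤ) (ω : Ω) : Fin d → ℝ :=
  ζ (t - 1) ω • S.B (t - 1) ω + (ζ (t - 1) ω) ^ 2 • S.V (t - 1) ω + S.Δ t ω

/-- The steady-state mean `E[Γ_0]`. -/
def mean : Fin d → ℝ := fun i => ∫ ω, S.Γ 0 ω i ∂μ

/-- `R_D(t) = E[D_tᵀ D_0]`. -/
def R_D (t : ℤ) : Matrix (Fin d) (Fin d) ℝ := crossMoment μ (S.D t) (S.D 0)

/-- `R_{D,ζ}(t) = E[D_tᵀ ζ_0]`. -/
def R_Dζ (t : ℤ) : Fin d → ℝ := fun i => ∫ ω, S.D t ω i * ζ 0 ω ∂μ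

/-- `R_{Γ,ζ}(t) = E[Γ_tᵀ ζ_0]`. -/
def R_Γζ (t : ℤ) : Fin d → ℝ := fun i => ∫ ω, S.Γ t ω i * ζ 0 ω ∂μ

/-- `R_{Bζ}(t) = E[B_t ζ_t B_0ᵀ ζ_0]`. -/
def R_Bζ (t : ℤ) : Matrix (Fin d) (Fin d) ℝ :=
  crossMoment μ (fun ω => ζ t ω • S.B t ω) (fun ω => ζ 0 ω • S.B 0 ω)

/-- `R_Δ(t) = E[Δ_tᵀ Δ_0]`. -/
def R_Δ (t : ℤ) : Matrix (Fin d) (Fin d) ℝ := crossMoment μ (S.Δ t) (S.Δ 0)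

/-- `R_{Bζ,Δ}(t) = E[B_t ζ_t Δ_0]`. -/
def R_BζΔ (t : ℤ) : Matrix (Fin d) (Fin d) ℝ :=
  crossMoment μ (fun ω => ζ t ω • S.B t ω) (S.Δ 0)

/-- `R_{Vζ²,Δ}(t) = E[V_t ζ_t² Δ_0]`. -/
def R_VζζΔ (t : ℤ) : Matrix (Fin d) (Fin d) ℝ :=
  crossMoment μ (fun ω => (ζ t ω) ^ 2 • S.V t ω) (S.Δ 0)

/-- `R_{Δ²,ζ}(t) = E[Δ_tᵀ Δ_t ζ_0]`. -/
def R_ΔΔζ (t : ℤ) : Matrix (Fin d) (Fin d) ℝ :=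
  Matrix.of fun i j => ∫ ω, S.Δ t ω i * S.Δ t ω j * ζ 0 ω ∂μ

end StationarySolution

end Proc

/-- Every entry of the matrix is bounded by `c` in absolute value. -/
def EntriesLE {d : ℕ} (M : Matrix (Fin d) (Fin d) ℝ) (c : ℝ) : Prop := ∀ i j, |M i j| ≤ c

/-- `Π₀ - P₀ᵀ Π₀ P₀`, where `Π₀` is the diagonal matrix of `p`. -/
def sigmaBullet {d : ℕ} (Q : Matrix (Fin d) (Fin d) ℝ) (p : Fin d → ℝ) :
    Matrix (Fin d) (Fin d) ℝ :=
  diagonal p - Qᵀ * diagonal p * Q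

end

end PerturbedChain

/-! The chain satisfies `Γ_{t+1} = Γ_t P_{ζ_t} + Δ_{t+1}`, where `Δ_{t+1}` is orthogonal to every
bounded variable known at time `t`. Here "known" includes the whole disturbance, future as well as
past, because the noise `N` is independent of `ζ` (`integral_mul_Δ_succ`). Hence for such a `U` the
row vectors `E[U Γ_t]` satisfy `E[U Γ_{t+1}] = E[U Γ_t P_{ζ_t}]`, and a Taylor expansion of `P`
turns this into a recursion driven by `P 0`, with a one-step error of order `ε`, or `ε²` once the
linear term is kept, times the size of `U`.

These errors must not accumulate with time. `P 0` preserves the total mass of a row vector and,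
being irreducible and aperiodic, has a power that strictly contracts zero-sum vectors in `ℓ¹`. So a
zero-sum recursion with forcing at most `b` stays below `κ b` over any horizon
(`exists_responseBound`). Differences between `E[U Γ_t]` and its approximations have zero sum, since
both sides have mass `E[U]`.

Four consequences carry the theorem, with `Z` a bounded function of `ζ`. `E[Z Γ_t] = E[Z] π₀ +
O(ε|Z|)` (`l1_moment_sub_invariant_le`). `E[U Γ_n] = E[U Γ_0] P_0^n + O(ε|U|)` for `U` known at time
zero (`l1_moment_sub_pow_le`), with a second-order version (`l1_moment_sub_recursion_le`). `E[Z Δ_tᵀ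
Δ_t] = E[Z] Σ + O(ε|Z|)`, with `Σ` the unperturbed covariance (`abs_integral_Δ_mul_Δ_sub_le`).

What remains is counting powers of `ε`. Correlations with two factors of `ζ` already have size `ε²`,
so a first-order law suffices. `R_{Bζ,Δ}` has one factor and needs the second-order law. `R_Δ(0)`
has none: it has an exact formula, in which `P` is expanded up to a cubic remainder while `E[Γ]` and
`E[Γᵀζ]` stay unexpanded. -/

namespace PerturbedChain

/-! ### The `ℓ¹` norm and the action of stochastic matrices on row vectors. -/

noncomputable section

/-- The `ℓ¹` norm of a row vector. -/
def l1 {d : ℕ} (v : Fin d → ℝ) : ℝ := ∑ i, |v i|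

variable {d : ℕ}

lemma l1_nonneg (v : Fin d → ℝ) : 0 ≤ l1 v := Finset.sum_nonneg fun _ _ => abs_nonneg _

lemma abs_le_l1 (v : Fin d → ℝ) (i : Fin d) : |v i| ≤ l1 v :=
  Finset.single_le_sum (f := fun i => |v i|) (fun _ _ => abs_nonneg _) (Finset.mem_univ i)

lemma l1_add_le (v w : Fin d → ℝ) : l1 (v + w) ≤ l1 v + l1 w := by
  unfold l1
  rw [← Finset.sum_add_distrib]
  exact Finset.sum_le_sum fun i _ => abs_add_le _ _

lemma l1_zero : l1 (0 : Fin d → ℝ) = 0 := by simp [l1]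

lemma l1_smul (c : ℝ) (v : Fin d → ℝ) : l1 (c • v) = |c| * l1 v := by
  simp [l1, abs_mul, Finset.mul_sum]

/-- Bilinear estimate: a matrix with bounded entries acting on a vector. -/
lemma abs_vecMul_le {v : Fin d → ℝ} {M : Matrix (Fin d) (Fin d) ℝ} {K : ℝ}
    (hM : ∀ i j, |M i j| ≤ K) (j : Fin d) : |(v ᵥ* M) j| ≤ l1 v * K := by
  simp only [vecMul, dotProduct, l1, Finset.sum_mul]
  refine (Finset.abs_sum_le_sum_abs _ _).trans (Finset.sum_le_sum fun i _ => ?_)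
  rw [abs_mul]
  exact mul_le_mul_of_nonneg_left (hM i j) (abs_nonneg _)

lemma l1_vecMul_le_of_row_sum {v : Fin d → ℝ} {M : Matrix (Fin d) (Fin d) ℝ} {θ : ℝ}
    (hM : ∀ i j, 0 ≤ M i j) (hs : ∀ i, ∑ j, M i j = θ) : l1 (v ᵥ* M) ≤ θ * l1 v := by
  have h : ∀ j, |(v ᵥ* M) j| ≤ ∑ i, |v i| * M i j := fun j => by
    simp only [vecMul, dotProduct]
    refine (Finset.abs_sum_le_sum_abs _ _).trans (Finset.sum_le_sum fun i _ => ?_)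
    rw [abs_mul, abs_of_nonneg (hM i j)]
  calc l1 (v ᵥ* M) ≤ ∑ j, ∑ i, |v i| * M i j := Finset.sum_le_sum fun j _ => h j
    _ = θ * l1 v := by
      rw [Finset.sum_comm]
      simp only [← Finset.mul_sum, hs, l1]
      rw [← Finset.sum_mul, mul_comm]

lemma l1_vecMul_le {v : Fin d → ℝ} {Q : Matrix (Fin d) (Fin d) ℝ}
    (hQ : Q ∈ rowStochastic ℝ (Fin d)) : l1 (v ᵥ* Q) ≤ l1 v := by
  have := l1_vecMul_le_of_row_sum (v := v) (M := Q) (θ := 1)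
    (fun i j => nonneg_of_mem_rowStochastic hQ) (sum_row_of_mem_rowStochastic hQ)
  linarith

lemma sum_entries_vecMul {v : Fin d → ℝ} {M : Matrix (Fin d) (Fin d) ℝ} {θ : ℝ}
    (hs : ∀ i, ∑ j, M i j = θ) : ∑ j, (v ᵥ* M) j = θ * ∑ i, v i := by
  simp only [vecMul, dotProduct]
  rw [Finset.sum_comm]
  simp only [← Finset.mul_sum, hs]
  rw [← Finset.sum_mul, mul_comm]

/-! ### Mixing of the unperturbed chain and uniform response bounds. -/

/-- An irreducible aperiodic transition matrix is primitive. -/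
theorem exists_pow_pos {Q : Matrix (Fin d) (Fin d) ℝ} (hirr : Q.IsIrreducible)
    (hap : Aperiodic Q) : ∃ k : ℕ, ∀ i j, 0 < (Q ^ k) i j := by
  have hnn := hirr.nonneg
  have hnnp : ∀ n i j, 0 ≤ (Q ^ n) i j := fun n i j => Matrix.pow_apply_nonneg hnn n i j
  have hmul : ∀ m n i j l, 0 < (Q ^ m) i j → 0 < (Q ^ n) j l → 0 < (Q ^ (m + n)) i l := by
    intro m n i j l h1 h2
    rw [pow_add, Matrix.mul_apply]
    exact (mul_pos h1 h2).trans_le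
      (Finset.single_le_sum (f := fun x => (Q ^ m) i x * (Q ^ n) x l)
        (fun x _ => mul_nonneg (hnnp _ _ _) (hnnp _ _ _)) (Finset.mem_univ j))
  have hdiag : ∀ i, ∃ n₀, ∀ n ≥ n₀, 0 < (Q ^ n) i i := by
    intro i
    let s : Set ℕ := {n | 1 ≤ n ∧ 0 < (Q ^ n) i i}
    -- The return times generate a numerical semigroup; gcd one means that it contains all large
    -- integers.
    have hg : Nat.setGcd s = 1 := hap i _ fun n h1 h2 => Nat.setGcd_dvd_of_mem ⟨h1, h2⟩
    obtain ⟨n₀, h₀⟩ := Nat.exists_mem_closure_of_ge s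
    refine ⟨n₀, fun n hn => ?_⟩
    have := h₀ n hn (by rw [hg]; exact one_dvd _)
    clear hn
    induction this using AddSubmonoid.closure_induction with
    | mem x hx => exact hx.2
    | zero => simp
    | add x y _ _ hx hy => exact hmul x y i i i hx hy
  choose n₀ hn₀ using hdiag
  choose k hk hkpos using (Matrix.isIrreducible_iff_exists_pow_pos hnn).1 hirr
  -- The exponent exceeds every `n₀ i + k i j`, so a path from `i` to `j` is a long loop at `i`
  -- followed by the fixed path of length `k i j`.
  refine ⟨∑ i, n₀ i + ∑ i, ∑ j, k i j, fun i j => ?_⟩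
  have h1 : n₀ i ≤ ∑ i, n₀ i :=
    Finset.single_le_sum (f := n₀) (fun _ _ => Nat.zero_le _) (Finset.mem_univ i)
  have h2 : k i j ≤ ∑ i, ∑ j, k i j :=
    (Finset.single_le_sum (f := k i) (fun _ _ => Nat.zero_le _) (Finset.mem_univ j)).trans
      (Finset.single_le_sum (f := fun i => ∑ j, k i j) (fun _ _ => Nat.zero_le _)
        (Finset.mem_univ i))
  have h3 := hmul (∑ i, n₀ i + ∑ i, ∑ j, k i j - k i j) (k i j) i i j
    (hn₀ i _ (by omega)) (hkpos i j)
  rwa [Nat.sub_add_cancel (by omega)] at h3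

/-- Some power of an irreducible aperiodic transition matrix is a strict contraction, in the `ℓ¹`
norm, of the space of row vectors with zero sum. -/
theorem exists_pow_contraction {Q : Matrix (Fin d) (Fin d) ℝ} (hQ : Q ∈ rowStochastic ℝ (Fin d))
    (hirr : Q.IsIrreducible) (hap : Aperiodic Q) :
    ∃ m : ℕ, ∃ θ : ℝ, 0 ≤ θ ∧ θ < 1 ∧
      ∀ v : Fin d → ℝ, ∑ i, v i = 0 → l1 (v ᵥ* Q ^ m) ≤ θ * l1 v := by
  obtain ⟨m, hm⟩ := exists_pow_pos hirr hap
  rcases Nat.eq_zero_or_pos d with rfl | hd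
  · exact ⟨m, 0, le_rfl, one_pos, fun v _ => by simp [l1]⟩
  have : Nonempty (Fin d) := ⟨⟨0, hd⟩⟩
  obtain ⟨p, hp⟩ := Finite.exists_min fun p : Fin d × Fin d => (Q ^ m) p.1 p.2
  set α := (Q ^ m) p.1 p.2
  have hα : 0 < α := hm _ _
  have hsum := sum_row_of_mem_rowStochastic (Submonoid.pow_mem _ hQ m)
  have hrow : ∀ i, ∑ j, ((Q ^ m) i j - α) = 1 - d * α := fun i => by
    simp [Finset.sum_sub_distrib, hsum i]
  have hdR : (0 : ℝ) < d := by exact_mod_cast hd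
  refine ⟨m, 1 - d * α, ?_, by nlinarith, fun v hv => ?_⟩
  · rw [← hrow p.1]
    exact Finset.sum_nonneg fun j _ => sub_nonneg.2 (hp (p.1, j))
  -- Doeblin's argument: subtracting the least entry `α` from all entries does not change the action
  -- on zero-sum vectors, and leaves a nonnegative matrix with row sums `1 - d α`.
  · have : v ᵥ* Q ^ m = v ᵥ* Matrix.of fun i j => (Q ^ m) i j - α := by
      ext j
      simp [vecMul, dotProduct, mul_sub, Finset.sum_sub_distrib, ← Finset.sum_mul, hv]
    rw [this]
    exact l1_vecMul_le_of_row_sum (fun i j => sub_nonneg.2 (hp (i, j))) hrow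

/-- `Q` does not expand the `ℓ¹` norm, so one-step errors at most add up. The linear growth is
harmless because the bound is used only up to the contraction time `m`. -/
lemma l1_sub_vecMul_pow_le {Q : Matrix (Fin d) (Fin d) ℝ} (hQ : Q ∈ rowStochastic ℝ (Fin d))
    {v : ℕ → Fin d → ℝ} {b : ℝ} (h : ∀ n, l1 (v (n + 1) - v n ᵥ* Q) ≤ b) (n : ℕ) :
    l1 (v n - v 0 ᵥ* Q ^ n) ≤ n * b := by
  induction n with
  | zero => simp [l1_zero]
  | succ n ih =>
    have e : v (n + 1) - v 0 ᵥ* Q ^ (n + 1)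
        = (v (n + 1) - v n ᵥ* Q) + (v n - v 0 ᵥ* Q ^ n) ᵥ* Q := by
      rw [sub_vecMul, vecMul_vecMul, ← pow_succ]; abel
    rw [e]
    have h1 := l1_add_le (v (n + 1) - v n ᵥ* Q) ((v n - v 0 ᵥ* Q ^ n) ᵥ* Q)
    have h2 := l1_vecMul_le (v := v n - v 0 ᵥ* Q ^ n) hQ
    push_cast
    linarith [h n]

/-- The number `κ` bounds the response of zero-sum recursions driven by `Q`: if the increments
`v (t + 1) - v t Q` are at most `b`, then `v` is at most `κ b`, both for recursions started at zero
and for bounded two-sided recursions. -/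
structure ResponseBound (Q : Matrix (Fin d) (Fin d) ℝ) (κ : ℝ) : Prop where
  nonneg : 0 ≤ κ
  forward : ∀ (v : ℕ → Fin d → ℝ) (b : ℝ), v 0 = 0 → (∀ n, ∑ i, v n i = 0) →
    (∀ n, l1 (v (n + 1) - v n ᵥ* Q) ≤ b) → ∀ n, l1 (v n) ≤ κ * b
  twoSided : ∀ (v : ℤ → Fin d → ℝ) (b c : ℝ), (∀ t, l1 (v t) ≤ c) → (∀ t, ∑ i, v t i = 0) →
    (∀ t, l1 (v (t + 1) - v t ᵥ* Q) ≤ b) → ∀ t, l1 (v t) ≤ κ * b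

/-- Over `m` steps the norm obeys `x ↦ θ x + m b`, whose fixed point `m b / (1 - θ)` gives `κ = m /
(1 - θ)`. Forward recursions stay below the fixed point by induction in jumps of `m`; for two-sided
ones, starting ever further in the past makes the a priori bound `c` contribute only `θ ^ n c`. -/
theorem exists_responseBound {Q : Matrix (Fin d) (Fin d) ℝ} (hQ : Q ∈ rowStochastic ℝ (Fin d))
    (hirr : Q.IsIrreducible) (hap : Aperiodic Q) : ∃ κ, ResponseBound Q κ := by
  obtain ⟨m, θ, hθ0, hθ1, hθ⟩ := exists_pow_contraction hQ hirr hap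
  have h1θ : 0 < 1 - θ := by linarith
  have step : ∀ (v : ℕ → Fin d → ℝ) (b : ℝ), (∑ i, v 0 i = 0) →
      (∀ n, l1 (v (n + 1) - v n ᵥ* Q) ≤ b) → l1 (v m) ≤ θ * l1 (v 0) + m * b := by
    intro v b h0 h
    have h1 := l1_sub_vecMul_pow_le hQ h m
    have h2 := l1_add_le (v m - v 0 ᵥ* Q ^ m) (v 0 ᵥ* Q ^ m)
    rw [sub_add_cancel] at h2
    linarith [hθ (v 0) h0]
  have fix : ∀ b : ℝ, θ * (m / (1 - θ) * b) + m * b = m / (1 - θ) * b := fun b => by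
    field_simp; ring
  refine ⟨m / (1 - θ), by positivity, ?_, ?_⟩
  · intro v b h0 hs h n
    have hb : 0 ≤ b := (l1_nonneg _).trans (h 0)
    induction n using Nat.strong_induction_on with
    | _ n ih =>
      rcases lt_or_ge n m with hn | hn
      · have h1 := l1_sub_vecMul_pow_le hQ h n
        rw [h0, zero_vecMul, sub_zero] at h1
        have h2 : (n : ℝ) * b ≤ m * b :=
          mul_le_mul_of_nonneg_right (by exact_mod_cast hn.le) hb
        have h3 : 0 ≤ (m : ℝ) / (1 - θ) * b := by positivity
        nlinarith [fix b, mul_nonneg hθ0 h3]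
      -- When `m = 0` a jump makes no progress, but then the contraction itself forces zero-sum
      -- vectors to vanish.
      · rcases Nat.eq_zero_or_pos m with rfl | hm
        · have h4 := hθ (v n) (hs n)
          simp only [pow_zero, vecMul_one] at h4
          have := l1_nonneg (v n)
          have : l1 (v n) ≤ 0 := by nlinarith
          simpa using this
        · have h1 := step (fun k => v (n - m + k)) b (by simpa using hs (n - m))
            (fun k => h (n - m + k))
          simp only [Nat.sub_add_cancel hn, add_zero] at h1
          have h2 := ih (n - m) (by omega)
          have := mul_le_mul_of_nonneg_left h2 hθ0
          linarith [fix b]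
  · intro v b c hc hs h t
    have key : ∀ n : ℕ, ∀ t, l1 (v t) ≤ θ ^ n * c + m / (1 - θ) * b := by
      have hb : 0 ≤ b := (l1_nonneg _).trans (h 0)
      have h3 : 0 ≤ (m : ℝ) / (1 - θ) * b := by positivity
      intro n
      induction n with
      | zero => intro t; linarith [hc t]
      | succ n ih =>
        intro t
        have h1 := step (fun k => v (t - m + k)) b (by simpa using hs (t - m))
          (fun k => by simpa [add_assoc] using h (t - m + k))
        simp only [sub_add_cancel, Nat.cast_zero, add_zero] at h1
        have := mul_le_mul_of_nonneg_left (ih (t - m)) hθ0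
        rw [pow_succ']
        linarith [fix b]
    have hlim : Filter.Tendsto (fun n : ℕ => θ ^ n * c + m / (1 - θ) * b) Filter.atTop
        (nhds (0 * c + m / (1 - θ) * b)) :=
      ((tendsto_pow_atTop_nhds_zero_of_lt_one hθ0 hθ1).mul_const c).add_const _
    have := ge_of_tendsto' hlim fun n => key n t
    linarith


/-! ### Taylor expansion of the transition matrices. -/

/-- Second-order Taylor expansion with cubic remainder for a `C²` function whose second derivative
is Lipschitz near zero. -/
theorem abs_sub_taylor_two_le {f : ℝ → ℝ} {δ : ℝ} (hδ : 0 < δ) {L : NNReal}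
    (hf : ContDiffOn ℝ 2 f (Set.Ioo (-δ) δ))
    (hL : LipschitzOnWith L (iteratedDeriv 2 f) (Set.Ioo (-δ) δ)) {z : ℝ} (hz : |z| < δ) :
    |f z - f 0 - z * deriv f 0 - z ^ 2 * (1 / 2 * iteratedDeriv 2 f 0)| ≤ L * |z| ^ 3 := by
  have hopen : IsOpen (Set.Ioo (-δ) δ) := isOpen_Ioo
  have h0 : (0 : ℝ) ∈ Set.Ioo (-δ) δ := ⟨by linarith, hδ⟩
  have hsub : Set.Icc (-|z|) |z| ⊆ Set.Ioo (-δ) δ := fun x hx =>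
    ⟨by linarith [hx.1], by linarith [hx.2]⟩
  have hd1 : ∀ x ∈ Set.Ioo (-δ) δ, HasDerivAt f (deriv f x) x := fun x hx =>
    ((hf.differentiableOn (by norm_num)).differentiableAt (hopen.mem_nhds hx)).hasDerivAt
  have hd2 : ∀ x ∈ Set.Ioo (-δ) δ, HasDerivAt (deriv f) (iteratedDeriv 2 f x) x := by
    intro x hx
    have h1 : ContDiffOn ℝ 1 (deriv f) (Set.Ioo (-δ) δ) :=
      ((contDiffOn_succ_iff_deriv_of_isOpen (n := 1) hopen).1
        (by simpa [one_add_one_eq_two] using hf)).2.2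
    have h2 := ((h1.differentiableOn (by norm_num)).differentiableAt
      (hopen.mem_nhds hx)).hasDerivAt
    rwa [iteratedDeriv_succ, iteratedDeriv_one]
  have hz0 : 0 ≤ |z| := abs_nonneg z
  have m0 : (0 : ℝ) ∈ Set.Icc (-|z|) |z| := ⟨by linarith, hz0⟩
  have mz : z ∈ Set.Icc (-|z|) |z| := abs_le.1 le_rfl
  -- The mean value inequality is applied twice, first to `f'` and then to `f`. Each use contributes
  -- a factor `|z|`, so the constant is `L` rather than the sharp `L / 6`.
  have first : ∀ x ∈ Set.Icc (-|z|) |z|,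
      |deriv f x - deriv f 0 - x * iteratedDeriv 2 f 0| ≤ L * |z| ^ 2 := by
    intro x hx
    have := (convex_Icc (-|z|) |z|).norm_image_sub_le_of_norm_hasDerivWithin_le
      (f := fun x => deriv f x - deriv f 0 - x * iteratedDeriv 2 f 0)
      (f' := fun x => iteratedDeriv 2 f x - iteratedDeriv 2 f 0) (C := L * |z|)
      (fun y hy => by
        have h3 := ((hd2 y (hsub hy)).sub_const (deriv f 0)).sub
          ((hasDerivAt_id y).mul_const (iteratedDeriv 2 f 0))
        simp only [one_mul] at h3
        exact h3.hasDerivWithinAt)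
      (fun y hy => by
        have h4 := hL.dist_le_mul y (hsub hy) 0 h0
        rw [Real.dist_eq, Real.dist_eq, sub_zero] at h4
        exact h4.trans (mul_le_mul_of_nonneg_left (abs_le.2 hy) L.2)) m0 hx
    simp only [Real.norm_eq_abs, sub_self, zero_mul, sub_zero] at this
    refine this.trans ?_
    rw [pow_two, ← mul_assoc]
    exact mul_le_mul_of_nonneg_left (abs_le.2 hx) (by positivity)
  have := (convex_Icc (-|z|) |z|).norm_image_sub_le_of_norm_hasDerivWithin_le
    (f := fun x => f x - f 0 - x * deriv f 0 - x ^ 2 * (1 / 2 * iteratedDeriv 2 f 0))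
    (f' := fun x => deriv f x - deriv f 0 - x * iteratedDeriv 2 f 0) (C := L * |z| ^ 2)
    (fun y hy => by
      have h3 := (((hd1 y (hsub hy)).sub_const (f 0)).sub
        ((hasDerivAt_id y).mul_const (deriv f 0))).sub
        ((hasDerivAt_pow 2 y).mul_const (1 / 2 * iteratedDeriv 2 f 0))
      refine (h3.congr_deriv ?_).hasDerivWithinAt
      push_cast
      ring)
    first m0 mz
  simp only [Real.norm_eq_abs, sub_self, zero_mul, sub_zero, ne_eq, OfNat.ofNat_ne_zero,
    not_false_eq_true, zero_pow] at this
  calc _ ≤ L * |z| ^ 2 * |z| := this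
    _ = _ := by ring

/-- Expansion of `P` at zero up to third order, with the constant `K`, on `[-δ, δ]`. -/
structure TaylorBound (P : ℝ → Matrix (Fin d) (Fin d) ℝ) (E W : Matrix (Fin d) (Fin d) ℝ)
    (K δ : ℝ) : Prop where
  one_le : 1 ≤ K
  pos : 0 < δ
  abs_E : ∀ i j, |E i j| ≤ K
  abs_W : ∀ i j, |W i j| ≤ K
  sum_E : ∀ i, ∑ j, E i j = 0
  order_one : ∀ z, |z| ≤ δ → ∀ i j, |P z i j - P 0 i j| ≤ K * |z|
  order_two : ∀ z, |z| ≤ δ → ∀ i j, |P z i j - P 0 i j - z * E i j| ≤ K * |z| ^ 2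
  order_three : ∀ z, |z| ≤ δ → ∀ i j,
    |P z i j - P 0 i j - z * E i j - z ^ 2 * (1 / 2 * W i j)| ≤ K * |z| ^ 3

theorem exists_taylorBound {P : ℝ → Matrix (Fin d) (Fin d) ℝ} (h : AssumptionA1 P) :
    ∃ K δ, TaylorBound P (firstDeriv P) (secondDeriv P) K δ := by
  obtain ⟨δ, hδ, L, hs⟩ := h.smooth
  set E := firstDeriv P
  set W := secondDeriv P
  obtain ⟨a, ha⟩ : ∃ a : ℝ, ∀ i j, |E i j| ≤ a := ⟨∑ i, ∑ j, |E i j|, fun i j =>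
    (abs_le_l1 (E i) j).trans (Finset.single_le_sum (f := fun i => l1 (E i))
      (fun _ _ => l1_nonneg _) (Finset.mem_univ i))⟩
  obtain ⟨b, hb⟩ : ∃ b : ℝ, ∀ i j, |W i j| ≤ b := ⟨∑ i, ∑ j, |W i j|, fun i j =>
    (abs_le_l1 (W i) j).trans (Finset.single_le_sum (f := fun i => l1 (W i))
      (fun _ _ => l1_nonneg _) (Finset.mem_univ i))⟩
  have ha' : ∀ i j, |E i j| ≤ |a| := fun i j => (ha i j).trans (le_abs_self a)
  have hb' : ∀ i j, |W i j| ≤ |b| := fun i j => (hb i j).trans (le_abs_self b)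
  have hL0 : (0 : ℝ) ≤ L := L.2
  have h3 : ∀ z, |z| < δ → ∀ i j,
      |P z i j - P 0 i j - z * E i j - z ^ 2 * (1 / 2 * W i j)| ≤ L * |z| ^ 3 :=
    fun z hz i j => abs_sub_taylor_two_le hδ (hs i j).1 (hs i j).2 hz
  have h2 : ∀ z, |z| < δ → |z| ≤ 1 → ∀ i j,
      |P z i j - P 0 i j - z * E i j| ≤ (L + |b|) * |z| ^ 2 := by
    intro z hz hz1 i j
    have e1 := abs_add_le (P z i j - P 0 i j - z * E i j - z ^ 2 * (1 / 2 * W i j))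
      (z ^ 2 * (1 / 2 * W i j))
    rw [sub_add_cancel] at e1
    have e2 : |z ^ 2 * (1 / 2 * W i j)| ≤ |z| ^ 2 * |b| := by
      rw [abs_mul, abs_mul, abs_pow]
      have : |(1 / 2 : ℝ)| * |W i j| ≤ |b| := by
        rw [abs_of_pos (by norm_num : (0 : ℝ) < 1 / 2)]; linarith [hb' i j, abs_nonneg (W i j)]
      gcongr
    have e3 : (L : ℝ) * |z| ^ 3 ≤ L * |z| ^ 2 :=
      mul_le_mul_of_nonneg_left (pow_le_pow_of_le_one (abs_nonneg z) hz1 (by norm_num)) hL0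
    linarith [h3 z hz i j]
  -- Halving `δ` puts the closed ball inside the open interval; radius at most one lets lower powers
  -- of `|z|` dominate higher ones.
  refine ⟨L + |a| + |b| + 1, min (δ / 2) 1, ?_, by positivity, fun i j => ?_, fun i j => ?_,
    fun i => ?_, ?_, ?_, ?_⟩
  · linarith [abs_nonneg a, abs_nonneg b]
  · linarith [ha' i j, abs_nonneg b]
  · linarith [hb' i j, abs_nonneg a]
  -- The rows of `P z` sum to one for every `z`, so those of the derivative sum to zero.
  · have hd : ∀ j, HasDerivAt (fun z => P z i j) (E i j) 0 := fun j =>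
      (((hs i j).1.differentiableOn (by norm_num)).differentiableAt
        (isOpen_Ioo.mem_nhds ⟨by linarith, hδ⟩)).hasDerivAt
    have h1 : HasDerivAt (fun z => ∑ j, P z i j) (∑ j, E i j) 0 :=
      HasDerivAt.fun_sum fun j _ => hd j
    have h4 : (fun z => ∑ j, P z i j) = fun _ => (1 : ℝ) :=
      funext fun z => sum_row_of_mem_rowStochastic (h.stochastic z) i
    rw [h4] at h1
    exact h1.unique (hasDerivAt_const _ _)
  all_goals
    intro z hz i j
    have hz1 : |z| < δ := by linarith [hz.trans (min_le_left _ _)]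
    have hz2 : |z| ≤ 1 := hz.trans (min_le_right _ _)
    have hz0 := abs_nonneg z
  · have e1 := abs_add_le (P z i j - P 0 i j - z * E i j) (z * E i j)
    rw [sub_add_cancel, abs_mul] at e1
    have e2 := h2 z hz1 hz2 i j
    have e3 : (L + |b|) * |z| ^ 2 ≤ (L + |b|) * |z| := by
      refine mul_le_mul_of_nonneg_left ?_ (by positivity)
      nlinarith
    nlinarith [mul_le_mul_of_nonneg_left (ha' i j) hz0]
  · refine (h2 z hz1 hz2 i j).trans (mul_le_mul_of_nonneg_right ?_ (by positivity))
    linarith [abs_nonneg a]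
  · refine (h3 z hz1 i j).trans (mul_le_mul_of_nonneg_right ?_ (by positivity))
    linarith [abs_nonneg a, abs_nonneg b]


/-! ### Essentially bounded variables and integration over an independent variable. -/

section EssBdd

/-- Almost everywhere measurable with respect to `m`, and essentially bounded. -/
structure EssBdd {Ω : Type*} (m : MeasurableSpace Ω) {m₀ : MeasurableSpace Ω} (μ : Measure Ω)
    (U : Ω → ℝ) : Prop where
  aesm : AEStronglyMeasurable[m] U μ
  bound : ∃ c, ∀ᵐ ω ∂μ, |U ω| ≤ c

namespace EssBdd

variable {Ω : Type*} {m m' m₀ : MeasurableSpace Ω} {μ : Measure Ω} {U V : Ω → ℝ}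

lemma mul (hU : EssBdd m μ U) (hV : EssBdd m μ V) : EssBdd m μ fun ω => U ω * V ω := by
  obtain ⟨c, hc⟩ := hU.bound
  obtain ⟨c', hc'⟩ := hV.bound
  refine ⟨hU.aesm.mul hV.aesm, c * c', ?_⟩
  filter_upwards [hc, hc'] with ω h1 h2
  rw [abs_mul]
  exact mul_le_mul h1 h2 (abs_nonneg _) ((abs_nonneg _).trans h1)

lemma add (hU : EssBdd m μ U) (hV : EssBdd m μ V) : EssBdd m μ fun ω => U ω + V ω := by
  obtain ⟨c, hc⟩ := hU.bound
  obtain ⟨c', hc'⟩ := hV.bound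
  refine ⟨hU.aesm.add hV.aesm, c + c', ?_⟩
  filter_upwards [hc, hc'] with ω h1 h2
  exact (abs_add_le _ _).trans (add_le_add h1 h2)

lemma const (c : ℝ) : EssBdd m μ fun _ => c :=
  ⟨aestronglyMeasurable_const, |c|, Filter.Eventually.of_forall fun _ => le_rfl⟩

lemma const_mul (c : ℝ) (hU : EssBdd m μ U) : EssBdd m μ fun ω => c * U ω := (const c).mul hU

lemma sub (hU : EssBdd m μ U) (hV : EssBdd m μ V) : EssBdd m μ fun ω => U ω - V ω := by
  simpa [sub_eq_add_neg] using hU.add (hV.const_mul (-1))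

lemma sum {ι : Type*} (s : Finset ι) {F : ι → Ω → ℝ} (h : ∀ i ∈ s, EssBdd m μ (F i)) :
    EssBdd m μ fun ω => ∑ i ∈ s, F i ω := by
  classical
  induction s using Finset.induction_on with
  | empty => simpa using const 0
  | insert a s ha ih =>
    simp only [Finset.sum_insert ha]
    exact (h a (by simp)).add (ih fun i hi => h i (by simp [hi]))

lemma mono (hU : EssBdd m μ U) (h : m ≤ m') : EssBdd m' μ U := ⟨hU.aesm.mono h, hU.bound⟩

lemma congr (hU : EssBdd m μ U) (h : U =ᵐ[μ] V) : EssBdd m μ V := by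
  obtain ⟨c, hc⟩ := hU.bound
  refine ⟨hU.aesm.congr h, c, ?_⟩
  filter_upwards [hc, h] with ω h1 h2
  rwa [← h2]

lemma of_measurable (hU : Measurable[m] U) {c : ℝ} (hc : ∀ᵐ ω ∂μ, |U ω| ≤ c) : EssBdd m μ U :=
  ⟨hU.stronglyMeasurable.aestronglyMeasurable, c, hc⟩

lemma integrable [IsFiniteMeasure μ] (hU : EssBdd m μ U) (h : m ≤ m₀) : Integrable U μ := by
  obtain ⟨c, hc⟩ := hU.bound
  exact Integrable.of_bound (hU.aesm.mono h) c (by simpa [Real.norm_eq_abs] using hc)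

end EssBdd

lemma abs_integral_le_of_ae {Ω : Type*} {m₀ : MeasurableSpace Ω} {μ : Measure Ω}
    [IsProbabilityMeasure μ] {U : Ω → ℝ} {c : ℝ} (h : ∀ᵐ ω ∂μ, |U ω| ≤ c) :
    |∫ ω, U ω ∂μ| ≤ c := by
  simpa using norm_integral_le_of_norm_le_const (μ := μ) (f := U) (C := c) h

/-- Freezing a random variable: integration of a function of two independent variables. -/
theorem integral_mul_of_indep {Ω 𝒩 : Type*} {m m₀ : MeasurableSpace Ω} [MeasurableSpace 𝒩]
    {μ : Measure Ω} [IsProbabilityMeasure μ] (hm : m ≤ m₀) {N : Ω → 𝒩} (hN : Measurable N)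
    (hind : Indep (MeasurableSpace.comap N inferInstance) m μ) {ζ U : Ω → ℝ}
    (hζ : Measurable[m] ζ) (hU : EssBdd m μ U) {f : ℝ × 𝒩 → ℝ} (hf : Measurable f)
    (hf1 : ∀ p, |f p| ≤ 1) :
    ∫ ω, U ω * f (ζ ω, N ω) ∂μ = ∫ ω, U ω * ∫ n, f (ζ ω, n) ∂(μ.map N) ∂μ := by
  -- An `m`-measurable version of `U` makes the pair `(U', ζ)` independent of `N`; the joint law is
  -- then a product and Fubini applies.
  obtain ⟨⟨U', hU', hUU⟩, c, hc⟩ := hU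
  have e1 : ∫ ω, U ω * f (ζ ω, N ω) ∂μ = ∫ ω, U' ω * f (ζ ω, N ω) ∂μ :=
    integral_congr_ae (by filter_upwards [hUU] with ω h; rw [h])
  have e2 : ∫ ω, U ω * ∫ n, f (ζ ω, n) ∂(μ.map N) ∂μ
      = ∫ ω, U' ω * ∫ n, f (ζ ω, n) ∂(μ.map N) ∂μ :=
    integral_congr_ae (by filter_upwards [hUU] with ω h; rw [h])
  rw [e1, e2]
  have hpm : Measurable[m] fun ω => (U' ω, ζ ω) := hU'.measurable.prodMk hζ
  have hp : Measurable fun ω => (U' ω, ζ ω) := hpm.mono hm le_rfl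
  have hif : IndepFun (fun ω => (U' ω, ζ ω)) N μ := by
    rw [IndepFun_iff_Indep]
    exact indep_of_indep_of_le_left hind.symm hpm.comap_le
  have hprod := (indepFun_iff_map_prod_eq_prod_map_map hp.aemeasurable hN.aemeasurable).1 hif
  have : IsProbabilityMeasure (μ.map N) := Measure.isProbabilityMeasure_map hN.aemeasurable
  have : IsProbabilityMeasure (μ.map fun ω => (U' ω, ζ ω)) :=
    Measure.isProbabilityMeasure_map hp.aemeasurable
  have hF : Measurable fun q : (ℝ × ℝ) × 𝒩 => q.1.1 * f (q.1.2, q.2) := by fun_prop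
  have hb : ∀ᵐ ω ∂μ, |U' ω| ≤ c := by
    filter_upwards [hc, hUU] with ω h1 h2
    rwa [← h2]
  have hFi : Integrable (fun q : (ℝ × ℝ) × 𝒩 => q.1.1 * f (q.1.2, q.2))
      ((μ.map fun ω => (U' ω, ζ ω)).prod (μ.map N)) := by
    rw [← hprod, integrable_map_measure hF.aestronglyMeasurable (hp.prodMk hN).aemeasurable]
    refine Integrable.of_bound (hF.comp (hp.prodMk hN)).aestronglyMeasurable c ?_
    filter_upwards [hb] with ω h
    simp only [Function.comp_apply, Real.norm_eq_abs, abs_mul]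
    nlinarith [hf1 (ζ ω, N ω), abs_nonneg (U' ω), abs_nonneg (f (ζ ω, N ω))]
  calc ∫ ω, U' ω * f (ζ ω, N ω) ∂μ
      = ∫ q, q.1.1 * f (q.1.2, q.2) ∂(μ.map fun ω => ((U' ω, ζ ω), N ω)) :=
        (integral_map (hp.prodMk hN).aemeasurable hF.aestronglyMeasurable).symm
    _ = ∫ r, ∫ n, r.1 * f (r.2, n) ∂(μ.map N) ∂(μ.map fun ω => (U' ω, ζ ω)) := by
        rw [hprod, integral_prod _ hFi]
    _ = ∫ r, r.1 * ∫ n, f (r.2, n) ∂(μ.map N) ∂(μ.map fun ω => (U' ω, ζ ω)) := by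
        simp only [integral_const_mul]
    _ = _ := by
        refine integral_map hp.aemeasurable ?_
        have hg : StronglyMeasurable fun z : ℝ => ∫ n, f (z, n) ∂(μ.map N) :=
          hf.stronglyMeasurable.integral_prod_right'
        exact (measurable_fst.mul (hg.measurable.comp measurable_snd)).aestronglyMeasurable

end EssBdd

/-! ### The σ-algebras of a process and of its past. -/

section Sigma

variable {Ω S : Type*} [MeasurableSpace S] (Y : ℤ → Ω → S)

lemma measurable_procSigma (t : ℤ) : Measurable[procSigma Y] (Y t) :=
  (comap_measurable (Y t)).mono (le_iSup (fun s => MeasurableSpace.comap (Y s) inferInstance) t)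
    le_rfl

lemma measurable_pastSigma {s t : ℤ} (h : s ≤ t) : Measurable[pastSigma Y t] (Y s) :=
  (comap_measurable (Y s)).mono
    (le_iSup₂ (f := fun s (_ : s ≤ t) => MeasurableSpace.comap (Y s) inferInstance) s h) le_rfl

lemma pastSigma_mono {s t : ℤ} (h : s ≤ t) : pastSigma Y s ≤ pastSigma Y t :=
  iSup₂_le fun _ hr => (measurable_pastSigma Y (hr.trans h)).comap_le

lemma procSigma_le {m₀ : MeasurableSpace Ω} (hY : ∀ t, Measurable (Y t)) : procSigma Y ≤ m₀ :=
  iSup_le fun s => (hY s).comap_le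

lemma pastSigma_le {m₀ : MeasurableSpace Ω} (hY : ∀ t, Measurable (Y t)) (t : ℤ) :
    pastSigma Y t ≤ m₀ :=
  iSup₂_le fun s _ => (hY s).comap_le

end Sigma

/-! ### Innovations as martingale differences. -/

namespace StationarySolution

variable {Ω : Type*} [m₀ : MeasurableSpace Ω] {d : ℕ} {P : ℝ → Matrix (Fin d) (Fin d) ℝ}
  {μ : Measure Ω} {ζ : ℤ → Ω → ℝ} {𝒩 : Type*} [MeasurableSpace 𝒩] (S : StationarySolution P μ ζ 𝒩)

/-- The information available at time `t`: the whole disturbance, and the past of the chain and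
of the driving noise. -/
abbrev history (t : ℤ) : MeasurableSpace Ω := procSigma ζ ⊔ pastSigma S.X t ⊔ pastSigma S.N t

lemma procSigma_le_history (t : ℤ) : procSigma ζ ≤ S.history t := le_sup_left.trans le_sup_left

lemma history_le (hζ : ∀ t, Measurable (ζ t)) (t : ℤ) : S.history t ≤ m₀ :=
  sup_le (sup_le (procSigma_le ζ hζ) (pastSigma_le S.X S.measurable_X t))
    (pastSigma_le S.N S.measurable_N t)

lemma history_mono {s t : ℤ} (h : s ≤ t) : S.history s ≤ S.history t :=
  sup_le_sup (sup_le_sup_left (pastSigma_mono _ h) _) (pastSigma_mono _ h)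

lemma measurable_X_history {s t : ℤ} (h : s ≤ t) : Measurable[S.history t] (S.X s) :=
  (measurable_pastSigma S.X h).mono (le_sup_right.trans le_sup_left) le_rfl

lemma abs_𝒢_le (z : ℝ) (n : 𝒩) (i j : Fin d) : |S.𝒢 z n i j| ≤ 1 := by
  rcases S.zero_or_one z n i j with h | h <;> simp [h]

/-- The conditional mean of the random transition matrix, given the disturbance. -/
def meanKernel (z : ℝ) (i j : Fin d) : ℝ := ∫ n, S.𝒢 z n i j ∂(μ.map (S.N 0))

lemma Γ_apply (t : ℤ) (ω : Ω) (i : Fin d) : S.Γ t ω i = if i = S.X t ω then 1 else 0 := by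
  simp [Γ, Pi.single_apply]

lemma Γ_nonneg (t : ℤ) (ω : Ω) (i : Fin d) : 0 ≤ S.Γ t ω i := by
  rw [Γ_apply]; split_ifs <;> norm_num

lemma Γ_le_one (t : ℤ) (ω : Ω) (i : Fin d) : S.Γ t ω i ≤ 1 := by
  rw [Γ_apply]; split_ifs <;> norm_num

lemma sum_Γ_mul (t : ℤ) (ω : Ω) (f : Fin d → ℝ) : ∑ i, S.Γ t ω i * f i = f (S.X t ω) := by
  simp [Γ_apply]

lemma Γ_vecMul (t : ℤ) (ω : Ω) (M : Matrix (Fin d) (Fin d) ℝ) (j : Fin d) :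
    (S.Γ t ω ᵥ* M) j = ∑ i, S.Γ t ω i * M i j := rfl

lemma Γ_mul_Γ (t : ℤ) (ω : Ω) (i j : Fin d) :
    S.Γ t ω i * S.Γ t ω j = if i = j then S.Γ t ω i else 0 := by
  simp only [Γ_apply]
  split_ifs <;> simp_all

/-- The chain predicted one step ahead: `Γ_t P_{ζ_t}`. -/
def pred (t : ℤ) (ω : Ω) (j : Fin d) : ℝ := ∑ i, S.Γ t ω i * P (ζ t ω) i j

lemma Δ_succ_apply (t : ℤ) (ω : Ω) (j : Fin d) : S.Δ (t + 1) ω j =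
    ∑ i, S.Γ t ω i * S.𝒢 (ζ t ω) (S.N (t + 1) ω) i j - S.pred t ω j := by
  simp only [Δ, add_sub_cancel_right, Γ_vecMul, Matrix.sub_apply, mul_sub,
    Finset.sum_sub_distrib, pred]

lemma Γ_succ_ae (t : ℤ) : ∀ᵐ ω ∂μ, ∀ j, S.Γ (t + 1) ω j =
    ∑ i, S.Γ t ω i * S.𝒢 (ζ t ω) (S.N (t + 1) ω) i j := by
  filter_upwards [S.dynamics t] with ω h j
  exact congrFun h j

lemma Δ_succ_ae (t : ℤ) : ∀ᵐ ω ∂μ, ∀ j, S.Δ (t + 1) ω j = S.Γ (t + 1) ω j - S.pred t ω j := by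
  filter_upwards [S.Γ_succ_ae t] with ω h j
  rw [Δ_succ_apply, h]

lemma essBdd_Γ {s t : ℤ} (h : s ≤ t) (i : Fin d) :
    EssBdd (S.history t) μ fun ω => S.Γ s ω i := by
  refine EssBdd.of_measurable (c := 1) ?_ (Filter.Eventually.of_forall fun ω => ?_)
  · have h1 : Measurable fun x : Fin d => (if i = x then (1 : ℝ) else 0) := measurable_from_top
    simp only [Γ_apply]
    exact h1.comp (S.measurable_X_history h)
  · rw [abs_of_nonneg (S.Γ_nonneg _ _ _)]
    exact S.Γ_le_one _ _ _

variable [IsProbabilityMeasure μ]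

lemma measurable_meanKernel (i j : Fin d) : Measurable fun z => S.meanKernel z i j := by
  have : IsProbabilityMeasure (μ.map (S.N 0)) :=
    Measure.isProbabilityMeasure_map (S.measurable_N 0).aemeasurable
  exact (StronglyMeasurable.integral_prod_right'
      (S.measurable_𝒢 i j).stronglyMeasurable).measurable

lemma abs_meanKernel_le (z : ℝ) (i j : Fin d) : |S.meanKernel z i j| ≤ 1 := by
  have : IsProbabilityMeasure (μ.map (S.N 0)) :=
    Measure.isProbabilityMeasure_map (S.measurable_N 0).aemeasurable
  exact abs_integral_le_of_ae (Filter.Eventually.of_forall fun n => S.abs_𝒢_le z n i j)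

lemma integral_mul_𝒢_eq_meanKernel (hζ : ∀ t, Measurable (ζ t)) {t : ℤ} {U : Ω → ℝ}
    (hU : EssBdd (S.history t) μ U) (i j : Fin d) :
    ∫ ω, U ω * S.𝒢 (ζ t ω) (S.N (t + 1) ω) i j ∂μ = ∫ ω, U ω * S.meanKernel (ζ t ω) i j ∂μ := by
  have := integral_mul_of_indep (S.history_le hζ t) (S.measurable_N (t + 1)) (S.causal t)
    ((measurable_procSigma ζ t).mono (S.procSigma_le_history t) le_rfl) hU (S.measurable_𝒢 i j)
    (fun p => S.abs_𝒢_le _ _ _ _)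
  simpa only [S.ident (t + 1), meanKernel] using this

/-- Averaging `𝒢` over the law of the noise gives a version of the conditional expectation given
`ζ`, by independence; the assumption on transitions identifies it with `P`. This also replaces `P`,
not assumed measurable away from zero, by a measurable kernel. -/
lemma meanKernel_ae_eq (hζ : ∀ t, Measurable (ζ t)) (t : ℤ) (i j : Fin d) :
    (fun ω => S.meanKernel (ζ t ω) i j) =ᵐ[μ] fun ω => P (ζ t ω) i j := by
  have hm := procSigma_le ζ hζ
  have hg : Measurable[procSigma ζ] fun ω => S.meanKernel (ζ t ω) i j :=
    (S.measurable_meanKernel i j).comp (measurable_procSigma ζ t)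
  have hgi : Integrable (fun ω => S.meanKernel (ζ t ω) i j) μ :=
    (EssBdd.of_measurable (c := 1) hg
      (Filter.Eventually.of_forall fun ω => S.abs_meanKernel_le _ _ _)).integrable hm
  have hfi : Integrable (fun ω => S.𝒢 (ζ t ω) (S.N (t + 1) ω) i j) μ :=
    Integrable.of_bound (C := 1) ((S.measurable_𝒢 i j).comp
      ((hζ t).prodMk (S.measurable_N (t + 1)))).aestronglyMeasurable
      (Filter.Eventually.of_forall fun ω => S.abs_𝒢_le _ _ _ _)
  refine (ae_eq_condExp_of_forall_setIntegral_eq hm hfi (fun s _ _ => hgi.integrableOn) ?_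
    hg.stronglyMeasurable.aestronglyMeasurable).trans (S.transition t i j)
  intro s hs _
  -- Testing against indicators of disturbance events yields the set integrals that characterise the
  -- conditional expectation.
  have hU : EssBdd (procSigma ζ) μ (s.indicator fun _ => (1 : ℝ)) := by
    refine EssBdd.of_measurable (c := 1) (measurable_const.indicator hs)
      (Filter.Eventually.of_forall fun ω => ?_)
    by_cases h : ω ∈ s <;> simp [h]
  have := S.integral_mul_𝒢_eq_meanKernel hζ (hU.mono (S.procSigma_le_history t)) i j
  have e : ∀ f : Ω → ℝ, ∫ ω, s.indicator (fun _ => (1 : ℝ)) ω * f ω ∂μ = ∫ ω in s, f ω ∂μ := by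
    intro f
    rw [← integral_indicator (hm s hs)]
    refine integral_congr_ae (Filter.Eventually.of_forall fun ω => ?_)
    by_cases h : ω ∈ s <;> simp [h]
  rw [e, e] at this
  exact this.symm

lemma integral_mul_𝒢 (hζ : ∀ t, Measurable (ζ t)) {t : ℤ} {U : Ω → ℝ}
    (hU : EssBdd (S.history t) μ U) (i j : Fin d) :
    ∫ ω, U ω * S.𝒢 (ζ t ω) (S.N (t + 1) ω) i j ∂μ = ∫ ω, U ω * P (ζ t ω) i j ∂μ := by
  rw [S.integral_mul_𝒢_eq_meanKernel hζ hU]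
  refine integral_congr_ae ?_
  filter_upwards [S.meanKernel_ae_eq hζ t i j] with ω h
  rw [h]

lemma essBdd_P (S : StationarySolution P μ ζ 𝒩) (hζ : ∀ t, Measurable (ζ t)) (t : ℤ) (i j : Fin d) :
    EssBdd (procSigma ζ) μ fun ω => P (ζ t ω) i j :=
  (EssBdd.of_measurable (c := 1)
    ((S.measurable_meanKernel i j).comp (measurable_procSigma ζ t))
    (Filter.Eventually.of_forall fun _ => S.abs_meanKernel_le _ _ _)).congr
      (S.meanKernel_ae_eq hζ t i j)

lemma essBdd_pred (hζ : ∀ t, Measurable (ζ t)) {s t : ℤ} (h : s ≤ t) (j : Fin d) :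
    EssBdd (S.history t) μ fun ω => S.pred s ω j :=
  EssBdd.sum _ fun i _ => (S.essBdd_Γ h i).mul
    ((S.essBdd_P hζ s i j).mono (S.procSigma_le_history t))

lemma essBdd_Δ (hζ : ∀ t, Measurable (ζ t)) {s t : ℤ} (h : s ≤ t) (j : Fin d) :
    EssBdd (S.history t) μ fun ω => S.Δ s ω j := by
  refine ((S.essBdd_Γ h j).sub (S.essBdd_pred hζ (s := s - 1) (by omega) j)).congr ?_
  have := S.Δ_succ_ae (s - 1)
  rw [sub_add_cancel] at this
  filter_upwards [this] with ω h
  exact (h j).symm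

/-- The noise `N (t + 1)` is independent of the history, so `𝒢` may be replaced by `P` against any
variable of the history. As the history contains all of `ζ`, later values of the disturbance may
enter `U`. -/
lemma integral_mul_Δ_succ (hζ : ∀ t, Measurable (ζ t)) {t : ℤ} {U : Ω → ℝ}
    (hU : EssBdd (S.history t) μ U) (j : Fin d) : ∫ ω, U ω * S.Δ (t + 1) ω j ∂μ = 0 := by
  have hle := S.history_le hζ t
  have hG : ∀ i, EssBdd m₀ μ fun ω => S.𝒢 (ζ t ω) (S.N (t + 1) ω) i j := fun i =>
    EssBdd.of_measurable (c := 1) ((S.measurable_𝒢 i j).comp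
      ((hζ t).prodMk (S.measurable_N (t + 1))))
      (Filter.Eventually.of_forall fun ω => S.abs_𝒢_le _ _ _ _)
  have hUΓ := fun i => hU.mul (S.essBdd_Γ le_rfl i)
  have e : ∀ ω, U ω * S.Δ (t + 1) ω j =
      ∑ i, ((U ω * S.Γ t ω i) * S.𝒢 (ζ t ω) (S.N (t + 1) ω) i j
        - (U ω * S.Γ t ω i) * P (ζ t ω) i j) := by
    intro ω
    rw [Δ_succ_apply, pred, Finset.sum_sub_distrib, mul_sub, Finset.mul_sum, Finset.mul_sum]
    simp only [mul_assoc]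
  have i1 := fun i => (((hUΓ i).mono hle).mul (hG i)).integrable le_rfl
  have i2 := fun i => ((hUΓ i).mul
    ((S.essBdd_P hζ t i j).mono (S.procSigma_le_history t))).integrable hle
  have i3 : ∀ i, Integrable (fun ω => (U ω * S.Γ t ω i) * S.𝒢 (ζ t ω) (S.N (t + 1) ω) i j
      - (U ω * S.Γ t ω i) * P (ζ t ω) i j) μ := fun i => (i1 i).sub (i2 i)
  simp only [e]
  refine (integral_finsetSum _ fun i _ => i3 i).trans ?_
  refine Finset.sum_eq_zero fun i _ => ?_
  rw [integral_sub (i1 i) (i2 i), S.integral_mul_𝒢 hζ (hUΓ i), sub_self]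

lemma integral_mul_Δ (hζ : ∀ t, Measurable (ζ t)) {s t : ℤ} (hst : s < t) {U : Ω → ℝ}
    (hU : EssBdd (S.history s) μ U) (j : Fin d) : ∫ ω, U ω * S.Δ t ω j ∂μ = 0 := by
  have := S.integral_mul_Δ_succ hζ (hU.mono (S.history_mono (t := t - 1) (by omega))) j
  rwa [sub_add_cancel] at this

/-! ### Transfer of stationarity to the innovations. -/

/-- The chain, its disturbance and its innovation at time `t`. -/
def triple (t : ℤ) (ω : Ω) : (Fin d → ℝ) × ℝ × (Fin d → ℝ) := (S.Γ t ω, ζ t ω, S.Δ t ω)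

/-- Joint stationarity of the chain, the disturbance and the innovations, at two times. -/
theorem integral_shift (hζ : ∀ t, Measurable (ζ t)) (s t k : ℤ)
    {Φ : ((Fin d → ℝ) × ℝ × (Fin d → ℝ)) × ((Fin d → ℝ) × ℝ × (Fin d → ℝ)) → ℝ}
    (hΦ : Measurable Φ) :
    ∫ ω, Φ (S.triple (s + k) ω, S.triple (t + k) ω) ∂μ
      = ∫ ω, Φ (S.triple s ω, S.triple t ω) ∂μ := by
  let γ : Fin d → Fin d → ℝ := fun x => Pi.single x 1
  have hγ : Measurable γ := measurable_from_top
  -- Only `(X, ζ)` is assumed stationary. Since `Δ_s = Γ_s - Γ_{s-1} P_{ζ_{s-1}}` almost surely, the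
  -- triple is a function of that path, measurable once `meanKernel` stands in for `P`.
  let τ : ℤ → (ℤ → Fin d × ℝ) → (Fin d → ℝ) × ℝ × (Fin d → ℝ) := fun s y =>
    (γ (y s).1, (y s).2, fun j => γ (y s).1 j
      - ∑ i, γ (y (s - 1)).1 i * S.meanKernel (y (s - 1)).2 i j)
  have hτ : ∀ s, Measurable (τ s) := by
    intro s
    have h1 : ∀ s, Measurable fun y : ℤ → Fin d × ℝ => γ (y s).1 := fun s =>
      hγ.comp (measurable_fst.comp (measurable_pi_apply s))
    have h1' : ∀ s i, Measurable fun y : ℤ → Fin d × ℝ => γ (y s).1 i := fun s i =>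
      (measurable_pi_apply i).comp (h1 s)
    have h2 : ∀ s, Measurable fun y : ℤ → Fin d × ℝ => (y s).2 := fun s =>
      measurable_snd.comp (measurable_pi_apply s)
    refine (h1 s).prodMk ((h2 s).prodMk (measurable_pi_lambda _ fun j => ?_))
    exact (h1' s j).sub (Finset.measurable_fun_sum _ fun i _ =>
      (h1' _ i).mul ((S.measurable_meanKernel i j).comp (h2 _)))
  have hY : ∀ k : ℤ, Measurable fun ω (t : ℤ) => (S.X (t + k) ω, ζ (t + k) ω) := fun k =>
    measurable_pi_lambda _ fun t => (S.measurable_X _).prodMk (hζ _)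
  have hae : ∀ s k, ∀ᵐ ω ∂μ,
      S.triple (s + k) ω = τ s fun t => (S.X (t + k) ω, ζ (t + k) ω) := by
    intro s k
    have h3 := S.Δ_succ_ae (s + k - 1)
    have h4 : ∀ᵐ ω ∂μ, ∀ i j, S.meanKernel (ζ (s + k - 1) ω) i j = P (ζ (s + k - 1) ω) i j :=
      ae_all_iff.2 fun i => ae_all_iff.2 fun j => S.meanKernel_ae_eq hζ (s + k - 1) i j
    rw [sub_add_cancel] at h3
    filter_upwards [h3, h4] with ω h5 h6
    refine Prod.ext rfl (Prod.ext rfl (funext fun j => ?_))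
    simp only [τ, triple, h5 j, pred, sub_add_eq_add_sub, h6]
    rfl
  have hΨ : Measurable fun y => Φ (τ s y, τ t y) := hΦ.comp ((hτ s).prodMk (hτ t))
  have key : ∀ k, ∫ ω, Φ (S.triple (s + k) ω, S.triple (t + k) ω) ∂μ =
      ∫ y, Φ (τ s y, τ t y) ∂(μ.map fun ω (t : ℤ) => (S.X (t + k) ω, ζ (t + k) ω)) := by
    intro k
    rw [integral_map (hY k).aemeasurable hΨ.aestronglyMeasurable]
    refine integral_congr_ae ?_
    filter_upwards [hae s k, hae t k] with ω h1 h2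
    rw [h1, h2]
  have h0 := key 0
  have hst0 := S.stationary k
  have hk := key k
  rw [hst0] at hk
  simp only [add_zero] at h0
  rw [hk, h0]

end StationarySolution


lemma abs_sum_mul_le {d : ℕ} {v f : Fin d → ℝ} {K : ℝ} (hf : ∀ i, |f i| ≤ K) :
    |∑ i, v i * f i| ≤ l1 v * K := by
  simp only [l1, Finset.sum_mul]
  refine (Finset.abs_sum_le_sum_abs _ _).trans (Finset.sum_le_sum fun i _ => ?_)
  rw [abs_mul]
  exact mul_le_mul_of_nonneg_left (hf i) (abs_nonneg _)

lemma l1_le_of_abs_le {d : ℕ} {v : Fin d → ℝ} {b : ℝ} (h : ∀ i, |v i| ≤ b) : l1 v ≤ d * b := by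
  refine (Finset.sum_le_sum fun i _ => h i).trans ?_
  simp

lemma transpose_mul_diagonal_mul_apply {d : ℕ} (M N : Matrix (Fin d) (Fin d) ℝ) (p : Fin d → ℝ)
    (i j : Fin d) : (Mᵀ * diagonal p * N) i j = ∑ k, p k * (M k i * N k j) := by
  rw [Matrix.mul_apply]
  simp only [Matrix.mul_diagonal, transpose_apply]
  exact Finset.sum_congr rfl fun k _ => by ring

lemma sigmaBullet_apply {d : ℕ} (Q : Matrix (Fin d) (Fin d) ℝ) (p : Fin d → ℝ) (i j : Fin d) :
    sigmaBullet Q p i j = (if i = j then p i else 0) - ∑ k, p k * (Q k i * Q k j) := by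
  rw [sigmaBullet, Matrix.sub_apply, diagonal_apply, transpose_mul_diagonal_mul_apply]

/-! ### Weighted moments of the chain. -/

/-- The data of the perturbation problem: a smooth family of transition matrices with mixing
`P 0`, and a disturbance process of amplitude `ε`. -/
structure SmallDisturbance {Ω : Type*} [MeasurableSpace Ω] {d : ℕ}
    (P : ℝ → Matrix (Fin d) (Fin d) ℝ) (π₀ : Fin d → ℝ) (E W : Matrix (Fin d) (Fin d) ℝ)
    (κ K δ ε : ℝ) (μ : Measure Ω) (ζ : ℤ → Ω → ℝ) : Prop where
  E_eq : E = firstDeriv P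
  W_eq : W = secondDeriv P
  stochastic : ∀ z, P z ∈ rowStochastic ℝ (Fin d)
  invariant : IsInvariantPmf (P 0) π₀
  response : ResponseBound (P 0) κ
  taylor : TaylorBound P E W K δ
  nonneg : 0 ≤ ε
  le_one : ε ≤ 1
  le_radius : ε ≤ δ
  measurable : ∀ t, Measurable (ζ t)
  bounded : ∀ t, ∀ᵐ ω ∂μ, |ζ t ω| ≤ ε

namespace StationarySolution

variable {Ω : Type*} [m₀ : MeasurableSpace Ω] {d : ℕ} {P : ℝ → Matrix (Fin d) (Fin d) ℝ}
  {μ : Measure Ω} {ζ : ℤ → Ω → ℝ} {𝒩 : Type*} [MeasurableSpace 𝒩]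
  (S : StationarySolution P μ ζ 𝒩) {π₀ : Fin d → ℝ} {E W : Matrix (Fin d) (Fin d) ℝ}
  {κ K δ ε : ℝ}

/-- The row vector `E[U Γ_t]`. -/
def moment (t : ℤ) (U : Ω → ℝ) : Fin d → ℝ := fun j => ∫ ω, U ω * S.Γ t ω j ∂μ

lemma essBdd_Γ₀ (t : ℤ) (i : Fin d) : EssBdd m₀ μ fun ω => S.Γ t ω i :=
  EssBdd.of_measurable (c := 1)
    ((measurable_from_top (f := fun x : Fin d => (Pi.single x 1 : Fin d → ℝ) i)).comp
      (S.measurable_X t))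
    (Filter.Eventually.of_forall fun ω => by
      rw [abs_of_nonneg (S.Γ_nonneg _ _ _)]; exact S.Γ_le_one _ _ _)

lemma pred_eq (t : ℤ) (ω : Ω) (j : Fin d) : S.pred t ω j = P (ζ t ω) (S.X t ω) j :=
  S.sum_Γ_mul t ω fun i => P (ζ t ω) i j

lemma essBdd_matrix_X (M : Matrix (Fin d) (Fin d) ℝ) {s t : ℤ} (h : s ≤ t) (j : Fin d) :
    EssBdd (S.history t) μ fun ω => M (S.X s ω) j := by
  have := EssBdd.sum Finset.univ fun i _ => (S.essBdd_Γ h i).mul (EssBdd.const (μ := μ) (M i j))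
  simpa only [S.sum_Γ_mul s _ fun i => M i j] using this

variable [IsProbabilityMeasure μ]

lemma sum_moment {U : Ω → ℝ} (hU : EssBdd m₀ μ U) (t : ℤ) (f : Fin d → ℝ) :
    ∑ j, S.moment t U j * f j = ∫ ω, U ω * f (S.X t ω) ∂μ := by
  have h : ∀ ω, U ω * f (S.X t ω) = ∑ j, (U ω * S.Γ t ω j) * f j := fun ω => by
    rw [← S.sum_Γ_mul t ω f, Finset.mul_sum]; simp only [mul_assoc]
  simp only [h, moment]
  rw [integral_finsetSum _ fun j _ => ((hU.mul (S.essBdd_Γ₀ t j)).integrable le_rfl).mul_const _]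
  simp only [integral_mul_const]

lemma sum_moment_one {U : Ω → ℝ} (hU : EssBdd m₀ μ U) (t : ℤ) :
    ∑ j, S.moment t U j = ∫ ω, U ω ∂μ := by
  simpa using S.sum_moment hU t fun _ => 1

lemma moment_vecMul {U : Ω → ℝ} (hU : EssBdd m₀ μ U) (t : ℤ) (M : Matrix (Fin d) (Fin d) ℝ)
    (j : Fin d) : (S.moment t U ᵥ* M) j = ∫ ω, U ω * M (S.X t ω) j ∂μ :=
  S.sum_moment hU t fun i => M i j

/-- By duality the norm is the pairing with the sign vector. Since `Γ_t` selects a single coordinate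
of it, no factor `d` appears. -/
lemma l1_moment_le {U : Ω → ℝ} (hU : EssBdd m₀ μ U) {c : ℝ} (hc : ∀ᵐ ω ∂μ, |U ω| ≤ c) (t : ℤ) :
    l1 (S.moment t U) ≤ c := by
  have h : l1 (S.moment t U) = ∑ j, S.moment t U j * (SignType.sign (S.moment t U j) : ℝ) := by
    simp only [l1, self_mul_sign]
  rw [h, S.sum_moment hU t fun j => (SignType.sign (S.moment t U j) : ℝ)]
  refine (le_abs_self _).trans (abs_integral_le_of_ae ?_)
  filter_upwards [hc] with ω hω
  rw [abs_mul]
  have h1 : ∀ s : SignType, |(s : ℝ)| ≤ 1 := fun s => by cases s <;> simp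
  nlinarith [h1 (SignType.sign (S.moment t U (S.X t ω))), abs_nonneg (U ω)]

lemma essBdd_P_X (hζ : ∀ t, Measurable (ζ t)) {s t : ℤ} (h : s ≤ t) (j : Fin d) :
    EssBdd (S.history t) μ fun ω => P (ζ s ω) (S.X s ω) j := by
  simpa only [pred_eq] using S.essBdd_pred hζ h j

lemma integral_mul_Γ_succ (hζ : ∀ t, Measurable (ζ t)) {t : ℤ} {U : Ω → ℝ}
    (hU : EssBdd (S.history t) μ U) (j : Fin d) :
    S.moment (t + 1) U j = ∫ ω, U ω * P (ζ t ω) (S.X t ω) j ∂μ := by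
  have hle := S.history_le hζ t
  have h := S.integral_mul_Δ_succ hζ hU j
  have e : ∫ ω, U ω * S.Δ (t + 1) ω j ∂μ
      = ∫ ω, (U ω * S.Γ (t + 1) ω j - U ω * P (ζ t ω) (S.X t ω) j) ∂μ :=
    integral_congr_ae (by
      filter_upwards [S.Δ_succ_ae t] with ω h1
      rw [h1, pred_eq, mul_sub])
  rw [e, integral_sub (((hU.mono hle).mul (S.essBdd_Γ₀ _ j)).integrable le_rfl)
    ((hU.mul (S.essBdd_P_X hζ le_rfl j)).integrable hle)] at h
  exact sub_eq_zero.1 h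

end StationarySolution

/-! ### First- and second-order expansion of the law of the chain. -/

namespace SmallDisturbance

variable {Ω : Type*} [m₀ : MeasurableSpace Ω] {d : ℕ} {P : ℝ → Matrix (Fin d) (Fin d) ℝ}
  {μ : Measure Ω} {ζ : ℤ → Ω → ℝ} {𝒩 : Type*} [MeasurableSpace 𝒩]
  {π₀ : Fin d → ℝ} {E W : Matrix (Fin d) (Fin d) ℝ} {κ K δ ε : ℝ}
  (hC : SmallDisturbance P π₀ E W κ K δ ε μ ζ)

include hC

lemma K_nonneg : 0 ≤ K := zero_le_one.trans hC.taylor.one_le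

lemma essBdd_ζ (t : ℤ) : EssBdd (procSigma ζ) μ (ζ t) :=
  EssBdd.of_measurable (measurable_procSigma ζ t) (hC.bounded t)

lemma abs_P_le_one (z : ℝ) (i j : Fin d) : |P z i j| ≤ 1 := by
  rw [abs_of_nonneg (nonneg_of_mem_rowStochastic (hC.stochastic z))]
  exact le_one_of_mem_rowStochastic (hC.stochastic z)

lemma order_one (t : ℤ) : ∀ᵐ ω ∂μ, ∀ i j, |P (ζ t ω) i j - P 0 i j| ≤ K * ε := by
  filter_upwards [hC.bounded t] with ω h i j
  exact (hC.taylor.order_one _ (h.trans hC.le_radius) i j).trans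
    (mul_le_mul_of_nonneg_left h hC.K_nonneg)

lemma order_two (t : ℤ) : ∀ᵐ ω ∂μ, ∀ i j,
    |P (ζ t ω) i j - P 0 i j - ζ t ω * E i j| ≤ K * ε ^ 2 := by
  filter_upwards [hC.bounded t] with ω h i j
  exact (hC.taylor.order_two _ (h.trans hC.le_radius) i j).trans
    (mul_le_mul_of_nonneg_left (pow_le_pow_left₀ (abs_nonneg _) h 2) hC.K_nonneg)

lemma order_three (t : ℤ) : ∀ᵐ ω ∂μ, ∀ i j,
    |P (ζ t ω) i j - P 0 i j - ζ t ω * E i j - ζ t ω ^ 2 * (1 / 2 * W i j)| ≤ K * ε ^ 3 := by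
  filter_upwards [hC.bounded t] with ω h i j
  exact (hC.taylor.order_three _ (h.trans hC.le_radius) i j).trans
    (mul_le_mul_of_nonneg_left (pow_le_pow_left₀ (abs_nonneg _) h 3) hC.K_nonneg)

lemma sum_vecMul_P (v : Fin d → ℝ) : ∑ j, (v ᵥ* P 0) j = ∑ i, v i := by
  rw [sum_entries_vecMul (sum_row_of_mem_rowStochastic (hC.stochastic 0)), one_mul]

lemma sum_vecMul_P_pow (v : Fin d → ℝ) (n : ℕ) : ∑ j, (v ᵥ* P 0 ^ n) j = ∑ i, v i := by
  rw [sum_entries_vecMul (sum_row_of_mem_rowStochastic (Submonoid.pow_mem _ (hC.stochastic 0) n)), one_mul]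

lemma sum_vecMul_E (v : Fin d → ℝ) : ∑ j, (v ᵥ* E) j = 0 := by
  rw [sum_entries_vecMul hC.taylor.sum_E, zero_mul]

lemma l1_vecMul_E_le (v : Fin d → ℝ) : l1 (v ᵥ* E) ≤ d * K * l1 v := by
  have := l1_le_of_abs_le fun j => abs_vecMul_le (v := v) hC.taylor.abs_E j
  linarith

variable (S : StationarySolution P μ ζ 𝒩)

lemma abs_Δ_le (t : ℤ) (i : Fin d) : ∀ᵐ ω ∂μ, |S.Δ t ω i| ≤ 1 := by
  have := S.Δ_succ_ae (t - 1)
  rw [sub_add_cancel] at this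
  filter_upwards [this] with ω h
  rw [h, S.pred_eq, abs_le]
  have h1 := S.Γ_nonneg t ω i
  have h2 := S.Γ_le_one t ω i
  have h3 : 0 ≤ P (ζ (t - 1) ω) (S.X (t - 1) ω) i := nonneg_of_mem_rowStochastic (hC.stochastic _)
  have h4 : P (ζ (t - 1) ω) (S.X (t - 1) ω) i ≤ 1 := le_one_of_mem_rowStochastic (hC.stochastic _)
  constructor <;> linarith

variable [IsProbabilityMeasure μ]

lemma l1_moment_succ_sub_le {t : ℤ} {U : Ω → ℝ} (hU : EssBdd (S.history t) μ U) {c : ℝ}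
    (hc : ∀ᵐ ω ∂μ, |U ω| ≤ c) :
    l1 (S.moment (t + 1) U - S.moment t U ᵥ* P 0) ≤ d * (c * (K * ε)) := by
  have hle := S.history_le hC.measurable t
  refine l1_le_of_abs_le fun j => ?_
  rw [Pi.sub_apply, S.integral_mul_Γ_succ hC.measurable hU, S.moment_vecMul (hU.mono hle),
    ← integral_sub ((hU.mul (S.essBdd_P_X hC.measurable le_rfl j)).integrable hle)
      ((hU.mul (S.essBdd_matrix_X _ le_rfl j)).integrable hle)]
  refine abs_integral_le_of_ae ?_
  filter_upwards [hc, hC.order_one t] with ω h1 h2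
  rw [← mul_sub, abs_mul]
  exact mul_le_mul h1 (h2 _ _) (abs_nonneg _) ((abs_nonneg _).trans h1)

lemma l1_moment_succ_sub_sub_le {t : ℤ} {U : Ω → ℝ} (hU : EssBdd (S.history t) μ U) {c : ℝ}
    (hc : ∀ᵐ ω ∂μ, |U ω| ≤ c) :
    l1 (S.moment (t + 1) U - S.moment t U ᵥ* P 0 - S.moment t (fun ω => U ω * ζ t ω) ᵥ* E)
      ≤ d * (c * (K * ε ^ 2)) := by
  have hle := S.history_le hC.measurable t
  have hUζ := hU.mul ((hC.essBdd_ζ t).mono (S.procSigma_le_history t))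
  have i1 := fun j => (hU.mul (S.essBdd_P_X hC.measurable le_rfl j)).integrable hle
  have i2 := fun j => (hU.mul (S.essBdd_matrix_X (P 0) le_rfl j)).integrable hle
  have i3 := fun j => (hUζ.mul (S.essBdd_matrix_X E le_rfl j)).integrable hle
  refine l1_le_of_abs_le fun j => ?_
  rw [Pi.sub_apply, Pi.sub_apply, S.integral_mul_Γ_succ hC.measurable hU,
    S.moment_vecMul (hU.mono hle), S.moment_vecMul (hUζ.mono hle), ← integral_sub (i1 j) (i2 j)]
  refine (congrArg abs (integral_sub ((i1 j).sub (i2 j)) (i3 j))).symm.trans_le ?_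
  refine abs_integral_le_of_ae ?_
  filter_upwards [hc, hC.order_two t] with ω h1 h2
  simp only [Pi.sub_apply]
  rw [← mul_sub, mul_assoc, ← mul_sub, abs_mul]
  exact mul_le_mul h1 (h2 _ _) (abs_nonneg _) ((abs_nonneg _).trans h1)

/-- Given the disturbance, the law of the chain is within `O(ε)` of `π₀`. -/
theorem l1_moment_sub_invariant_le {Z : Ω → ℝ} (hZ : EssBdd (procSigma ζ) μ Z) {c : ℝ}
    (hc : ∀ᵐ ω ∂μ, |Z ω| ≤ c) (t : ℤ) :
    l1 (S.moment t Z - (∫ ω, Z ω ∂μ) • π₀) ≤ κ * d * K * (c * ε) := by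
  have hZ0 := hZ.mono (procSigma_le ζ hC.measurable)
  -- A weight depending on `ζ` alone is known at every time, so the recursion runs over all of `ℤ`
  -- and needs no initial condition.
  have := hC.response.twoSided (fun t => S.moment t Z - (∫ ω, Z ω ∂μ) • π₀) (d * (c * (K * ε)))
    (c + |∫ ω, Z ω ∂μ| * l1 π₀) (fun t => ?_) (fun t => ?_) (fun t => ?_) t
  · calc _ ≤ _ := this
      _ = _ := by ring
  · have h1 := l1_add_le (S.moment t Z) (-((∫ ω, Z ω ∂μ) • π₀))
    rw [← neg_smul, l1_smul, abs_neg] at h1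
    rw [sub_eq_add_neg, ← neg_smul]
    linarith [S.l1_moment_le hZ0 hc t]
  · simp only [Pi.sub_apply, Pi.smul_apply, smul_eq_mul, Finset.sum_sub_distrib,
      S.sum_moment_one hZ0, ← Finset.mul_sum, hC.invariant.2.1]
    ring
  · have := hC.l1_moment_succ_sub_le S (t := t) (hZ.mono (S.procSigma_le_history t)) hc
    simp only [sub_vecMul, smul_vecMul, hC.invariant.2.2]
    rwa [sub_sub_sub_cancel_right]

/-- Over any horizon, the conditional law of the chain is within `O(ε)` of that of the
unperturbed chain. -/
theorem l1_moment_sub_pow_le {U : Ω → ℝ} (hU : EssBdd (S.history 0) μ U) {c : ℝ}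
    (hc : ∀ᵐ ω ∂μ, |U ω| ≤ c) (n : ℕ) :
    l1 (S.moment n U - S.moment 0 U ᵥ* P 0 ^ n) ≤ κ * d * K * (c * ε) := by
  have hU0 := hU.mono (S.history_le hC.measurable 0)
  have := hC.response.forward (fun n => S.moment n U - S.moment 0 U ᵥ* P 0 ^ n)
    (d * (c * (K * ε))) (by simp) (fun n => ?_) (fun n => ?_) n
  · calc _ ≤ _ := this
      _ = _ := by ring
  · simp only [Pi.sub_apply, Finset.sum_sub_distrib, hC.sum_vecMul_P_pow, S.sum_moment_one hU0,
      sub_self]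
  · have := hC.l1_moment_succ_sub_le S (t := n) (hU.mono (S.history_mono (by omega))) hc
    rw [sub_vecMul, vecMul_vecMul, ← pow_succ, sub_sub_sub_cancel_right]
    exact_mod_cast this

/-- Second-order expansion of the conditional law of the chain over any horizon. -/
theorem l1_moment_sub_recursion_le {U : Ω → ℝ} (hU : EssBdd (S.history 0) μ U) {c b : ℝ}
    (hc : ∀ᵐ ω ∂μ, |U ω| ≤ c) {w q : ℕ → Fin d → ℝ} (hw0 : w 0 = S.moment 0 U)
    (hw : ∀ n, w (n + 1) = w n ᵥ* P 0 + (q n ᵥ* P 0 ^ n) ᵥ* E)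
    (hq : ∀ n : ℕ, l1 (S.moment 0 (fun ω => U ω * ζ n ω) - q n) ≤ b) (n : ℕ) :
    l1 (S.moment n U - w n)
      ≤ κ * (d * (c * (K * ε ^ 2)) + d * K * (κ * d * K * (c * ε * ε)) + d * K * b) := by
  have hU0 := hU.mono (S.history_le hC.measurable 0)
  -- `P 0` preserves mass and `E` annihilates it, so the approximation keeps mass `E[U]` and the
  -- error has zero sum.
  have hsum : ∀ n, ∑ i, w n i = ∫ ω, U ω ∂μ := by
    intro n
    induction n with
    | zero => rw [hw0, S.sum_moment_one hU0]
    | succ n ih =>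
      simp only [hw, Pi.add_apply, Finset.sum_add_distrib, hC.sum_vecMul_P, hC.sum_vecMul_E, ih,
        add_zero]
  have hdK : 0 ≤ d * K := mul_nonneg (Nat.cast_nonneg d) hC.K_nonneg
  refine hC.response.forward (fun n => S.moment n U - w n) _ (by simp [hw0]) (fun n => ?_)
    (fun n => ?_) n
  · simp only [Pi.sub_apply, Finset.sum_sub_distrib, hsum, S.sum_moment_one hU0, sub_self]
  · have e : S.moment ((n + 1 : ℕ) : ℤ) U - w (n + 1) - (S.moment n U - w n) ᵥ* P 0
        = (S.moment (n + 1) U - S.moment n U ᵥ* P 0 - S.moment n (fun ω => U ω * ζ n ω) ᵥ* E)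
          + (S.moment n (fun ω => U ω * ζ n ω)
              - S.moment 0 (fun ω => U ω * ζ n ω) ᵥ* P 0 ^ n) ᵥ* E
          + ((S.moment 0 (fun ω => U ω * ζ n ω) - q n) ᵥ* P 0 ^ n) ᵥ* E := by
      rw [hw, Nat.cast_succ]
      simp only [sub_vecMul]
      abel
    have hUζ := hU.mul ((hC.essBdd_ζ n).mono (S.procSigma_le_history 0))
    have hcε : ∀ᵐ ω ∂μ, |U ω * ζ n ω| ≤ c * ε := by
      filter_upwards [hc, hC.bounded n] with ω h1 h2
      rw [abs_mul]
      exact mul_le_mul h1 h2 (abs_nonneg _) ((abs_nonneg _).trans h1)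
    have b1 := hC.l1_moment_succ_sub_sub_le S (hU.mono (S.history_mono (t := n) (by omega))) hc
    have b2 := (hC.l1_vecMul_E_le _).trans
      (mul_le_mul_of_nonneg_left (hC.l1_moment_sub_pow_le S hUζ hcε n) hdK)
    have b3 := (hC.l1_vecMul_E_le _).trans (mul_le_mul_of_nonneg_left
      ((l1_vecMul_le (Submonoid.pow_mem _ (hC.stochastic 0) n)).trans (hq n)) hdK)
    rw [e]
    exact (l1_add_le _ _).trans (add_le_add ((l1_add_le _ _).trans (add_le_add b1 b2)) b3)

/-- Conditional second moments of the innovations. -/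
theorem integral_Δ_mul_Δ {Z : Ω → ℝ} (hZ : EssBdd (procSigma ζ) μ Z) (t : ℤ) (i j : Fin d) :
    ∫ ω, Z ω * S.Δ (t + 1) ω i * S.Δ (t + 1) ω j ∂μ
      = (if i = j then S.moment (t + 1) Z i else 0)
        - ∫ ω, Z ω * (P (ζ t ω) (S.X t ω) i * P (ζ t ω) (S.X t ω) j) ∂μ := by
  have hle := S.history_le hC.measurable t
  have hle' := S.history_le hC.measurable (t + 1)
  have hZt := hZ.mono (S.procSigma_le_history t)
  have hZt' := hZ.mono (S.procSigma_le_history (t + 1))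
  have hp := fun j => S.essBdd_P_X hC.measurable (le_refl t) j
  have hΔ := fun j => S.essBdd_Δ hC.measurable (le_refl (t + 1)) j
  have hΓ := fun j => S.essBdd_Γ (le_refl (t + 1)) j
  have z : ∀ i j, ∫ ω, Z ω * P (ζ t ω) (S.X t ω) i * S.Δ (t + 1) ω j ∂μ = 0 := fun i j =>
    S.integral_mul_Δ_succ hC.measurable (hZt.mul (hp i)) j
  have hmono := S.history_mono (s := t) (t := t + 1) (by omega)
  have i1 := ((hZt'.mul (hΓ i)).mul (hΓ j)).integrable hle'
  have i2 := (hZt.mul ((hp i).mul (hp j))).integrable hle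
  have i3 := fun i j => (((hZt.mul (hp i)).mono hmono).mul (hΔ j)).integrable hle'
  -- With `Δ = Γ - p`, the product is `Γ_i Γ_j - p_i p_j` minus cross terms `p_i Δ_j + p_j Δ_i`,
  -- which integrate to zero.
  have e : ∀ᵐ ω ∂μ, Z ω * S.Δ (t + 1) ω i * S.Δ (t + 1) ω j
      = (Z ω * S.Γ (t + 1) ω i * S.Γ (t + 1) ω j
        - Z ω * (P (ζ t ω) (S.X t ω) i * P (ζ t ω) (S.X t ω) j))
        - (Z ω * P (ζ t ω) (S.X t ω) i * S.Δ (t + 1) ω j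
          + Z ω * P (ζ t ω) (S.X t ω) j * S.Δ (t + 1) ω i) := by
    filter_upwards [S.Δ_succ_ae t] with ω h
    rw [h, h, S.pred_eq, S.pred_eq]
    ring
  have hΓΓ : ∫ ω, Z ω * S.Γ (t + 1) ω i * S.Γ (t + 1) ω j ∂μ
      = if i = j then S.moment (t + 1) Z i else 0 := by
    simp only [mul_assoc, S.Γ_mul_Γ]
    split_ifs with h
    · rfl
    · simp
  have i12 : Integrable (fun ω => Z ω * S.Γ (t + 1) ω i * S.Γ (t + 1) ω j
      - Z ω * (P (ζ t ω) (S.X t ω) i * P (ζ t ω) (S.X t ω) j)) μ := i1.sub i2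
  have i33 : Integrable (fun ω => Z ω * P (ζ t ω) (S.X t ω) i * S.Δ (t + 1) ω j
      + Z ω * P (ζ t ω) (S.X t ω) j * S.Δ (t + 1) ω i) μ := (i3 i j).add (i3 j i)
  rw [integral_congr_ae e, integral_sub i12 i33, integral_sub i1 i2,
    integral_add (i3 i j) (i3 j i), z, z, hΓΓ, add_zero, sub_zero]

/-- Given the disturbance, the covariance of the innovations is within `O(ε)` of that of the
unperturbed chain. -/
theorem abs_integral_Δ_mul_Δ_sub_le {Z : Ω → ℝ} (hZ : EssBdd (procSigma ζ) μ Z) {c : ℝ}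
    (hc : ∀ᵐ ω ∂μ, |Z ω| ≤ c) (t : ℤ) (i j : Fin d) :
    |∫ ω, Z ω * S.Δ t ω i * S.Δ t ω j ∂μ - (∫ ω, Z ω ∂μ) * sigmaBullet (P 0) π₀ i j|
      ≤ (2 * (κ * d * K) + 2 * K) * (c * ε) := by
  obtain ⟨t, rfl⟩ : ∃ s, t = s + 1 := ⟨t - 1, by ring⟩
  have hle := S.history_le hC.measurable t
  have hZt := hZ.mono (S.procSigma_le_history t)
  have hp := fun j => S.essBdd_P_X hC.measurable (le_refl t) j
  have hp0 := fun j => S.essBdd_matrix_X (P 0) (le_refl t) j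
  have hZ0 := hZ.mono (procSigma_le ζ hC.measurable)
  rw [hC.integral_Δ_mul_Δ S hZ, sigmaBullet_apply]
  -- Each of the moments at `t + 1` and `t` costs `κ d K`; replacing `P_ζ` by `P 0` in both factors
  -- of the product costs `2 K`.
  have m1 := hC.l1_moment_sub_invariant_le S hZ hc (t + 1)
  have m2 := hC.l1_moment_sub_invariant_le S hZ hc t
  have b1 : |(if i = j then S.moment (t + 1) Z i else 0)
      - (∫ ω, Z ω ∂μ) * (if i = j then π₀ i else 0)| ≤ κ * d * K * (c * ε) := by
    split_ifs
    · exact (abs_le_l1 (S.moment (t + 1) Z - (∫ ω, Z ω ∂μ) • π₀) i).trans m1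
    · simpa using (l1_nonneg _).trans m1
  have b2 : |∑ k, (S.moment t Z - (∫ ω, Z ω ∂μ) • π₀) k * (P 0 k i * P 0 k j)|
      ≤ κ * d * K * (c * ε) := by
    refine (abs_sum_mul_le (K := 1) fun k => ?_).trans (by linarith)
    rw [abs_mul]
    exact mul_le_one₀ (hC.abs_P_le_one 0 k i) (abs_nonneg _) (hC.abs_P_le_one 0 k j)
  have b3 : |∫ ω, Z ω * (P (ζ t ω) (S.X t ω) i * P (ζ t ω) (S.X t ω) j) ∂μ
      - ∑ k, S.moment t Z k * (P 0 k i * P 0 k j)| ≤ c * (2 * (K * ε)) := by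
    rw [S.sum_moment hZ0 t fun k => P 0 k i * P 0 k j, ← integral_sub ((hZt.mul ((hp i).mul (hp j))).integrable hle)
      ((hZt.mul ((hp0 i).mul (hp0 j))).integrable hle)]
    refine abs_integral_le_of_ae ?_
    filter_upwards [hc, hC.order_one t] with ω h1 h2
    rw [← mul_sub, abs_mul]
    refine mul_le_mul h1 ?_ (abs_nonneg _) ((abs_nonneg _).trans h1)
    have e : P (ζ t ω) (S.X t ω) i * P (ζ t ω) (S.X t ω) j - P 0 (S.X t ω) i * P 0 (S.X t ω) j
        = (P (ζ t ω) (S.X t ω) i - P 0 (S.X t ω) i) * P (ζ t ω) (S.X t ω) j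
          + P 0 (S.X t ω) i * (P (ζ t ω) (S.X t ω) j - P 0 (S.X t ω) j) := by ring
    rw [e]
    refine (abs_add_le _ _).trans ?_
    rw [abs_mul, abs_mul]
    have h3 := mul_le_of_le_one_right (abs_nonneg (P (ζ t ω) (S.X t ω) i - P 0 (S.X t ω) i))
      (hC.abs_P_le_one (ζ t ω) (S.X t ω) j)
    have h4 := mul_le_of_le_one_left (abs_nonneg (P (ζ t ω) (S.X t ω) j - P 0 (S.X t ω) j))
      (hC.abs_P_le_one 0 (S.X t ω) i)
    linarith [h2 (S.X t ω) i, h2 (S.X t ω) j]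
  have e : ∑ k, (S.moment t Z - (∫ ω, Z ω ∂μ) • π₀) k * (P 0 k i * P 0 k j)
      = ∑ k, S.moment t Z k * (P 0 k i * P 0 k j)
        - (∫ ω, Z ω ∂μ) * ∑ k, π₀ k * (P 0 k i * P 0 k j) := by
    simp only [Pi.sub_apply, Pi.smul_apply, smul_eq_mul, sub_mul, Finset.sum_sub_distrib,
      Finset.mul_sum, mul_assoc]
  rw [e] at b2
  rw [abs_le] at b1 b2 b3 ⊢
  constructor <;> linarith [b1.1, b1.2, b2.1, b2.2, b3.1, b3.2]

/-- Past innovations are orthogonal to the predictable part of the chain. -/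
lemma moment_Δ_mul {Z : Ω → ℝ} (hZ : EssBdd (procSigma ζ) μ Z) (t : ℤ) (i j : Fin d) :
    S.moment t (fun ω => Z ω * S.Δ t ω j) i = ∫ ω, Z ω * S.Δ t ω i * S.Δ t ω j ∂μ := by
  obtain ⟨t, rfl⟩ : ∃ s, t = s + 1 := ⟨t - 1, by ring⟩
  have hle' := S.history_le hC.measurable (t + 1)
  have hZt := hZ.mono (S.procSigma_le_history t)
  have hp := hZt.mul (S.essBdd_P_X hC.measurable (le_refl t) i)
  have hmono := S.history_mono (s := t) (t := t + 1) (by omega)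
  have hΔ := fun j => S.essBdd_Δ hC.measurable (le_refl (t + 1)) j
  have i1 := (((hZt.mono hmono).mul (hΔ i)).mul (hΔ j)).integrable hle'
  have i2 := ((hp.mono hmono).mul (hΔ j)).integrable hle'
  have e : ∀ᵐ ω ∂μ, Z ω * S.Δ (t + 1) ω j * S.Γ (t + 1) ω i
      = Z ω * S.Δ (t + 1) ω i * S.Δ (t + 1) ω j
        + Z ω * P (ζ t ω) (S.X t ω) i * S.Δ (t + 1) ω j := by
    filter_upwards [S.Δ_succ_ae t] with ω h
    have := h i
    rw [S.pred_eq] at this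
    rw [this]
    ring
  rw [StationarySolution.moment, integral_congr_ae e, integral_add i1 i2,
    S.integral_mul_Δ_succ hC.measurable hp, add_zero]

end SmallDisturbance


lemma transpose_mul_apply_eq_vecMul {d : ℕ} (M N : Matrix (Fin d) (Fin d) ℝ) (i j : Fin d) :
    (Mᵀ * N) i j = ((fun k => N k j) ᵥ* M) i := by
  simp only [Matrix.mul_apply, vecMul, dotProduct, transpose_apply]
  exact Finset.sum_congr rfl fun k _ => mul_comm _ _

/-! ### Correlations of the disturbance terms. -/

namespace SmallDisturbance

variable {Ω : Type*} [m₀ : MeasurableSpace Ω] {d : ℕ} {P : ℝ → Matrix (Fin d) (Fin d) ℝ}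
  {μ : Measure Ω} {ζ : ℤ → Ω → ℝ} {𝒩 : Type*} [MeasurableSpace 𝒩]
  {π₀ : Fin d → ℝ} {E W : Matrix (Fin d) (Fin d) ℝ} {κ K δ ε : ℝ}
  (hC : SmallDisturbance P π₀ E W κ K δ ε μ ζ) (S : StationarySolution P μ ζ 𝒩)

include hC

lemma B_apply (t : ℤ) (ω : Ω) (i : Fin d) : S.B t ω i = E (S.X t ω) i := by
  rw [hC.E_eq]
  exact S.sum_Γ_mul t ω fun k => firstDeriv P k i

lemma V_apply (t : ℤ) (ω : Ω) (i : Fin d) : S.V t ω i = 1 / 2 * W (S.X t ω) i := by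
  rw [hC.W_eq]
  exact congrArg (1 / 2 * ·) (S.sum_Γ_mul t ω fun k => secondDeriv P k i)

lemma D_apply (t : ℤ) (ω : Ω) (i : Fin d) : S.D t ω i =
    ζ (t - 1) ω * E (S.X (t - 1) ω) i + ζ (t - 1) ω ^ 2 * (1 / 2 * W (S.X (t - 1) ω) i)
      + S.Δ t ω i := by
  simp only [StationarySolution.D, Pi.add_apply, Pi.smul_apply, smul_eq_mul, hC.B_apply,
    hC.V_apply]

lemma R_Bζ_apply (t : ℤ) (i j : Fin d) : S.R_Bζ t i j =
    ∫ ω, (ζ t ω * E (S.X t ω) i) * (ζ 0 ω * E (S.X 0 ω) j) ∂μ := by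
  simp only [StationarySolution.R_Bζ, crossMoment, of_apply, Pi.smul_apply, smul_eq_mul,
    hC.B_apply]

lemma R_BζΔ_apply (t : ℤ) (i j : Fin d) : S.R_BζΔ t i j =
    ∫ ω, (ζ t ω * E (S.X t ω) i) * S.Δ 0 ω j ∂μ := by
  simp only [StationarySolution.R_BζΔ, crossMoment, of_apply, Pi.smul_apply, smul_eq_mul,
    hC.B_apply]

lemma R_VζζΔ_apply (t : ℤ) (i j : Fin d) : S.R_VζζΔ t i j =
    ∫ ω, (ζ t ω ^ 2 * (1 / 2 * W (S.X t ω) i)) * S.Δ 0 ω j ∂μ := by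
  simp only [StationarySolution.R_VζζΔ, crossMoment, of_apply, Pi.smul_apply, smul_eq_mul,
    hC.V_apply]

lemma abs_mul_E_le (t : ℤ) (i : Fin d) : ∀ᵐ ω ∂μ, |ζ t ω * E (S.X t ω) i| ≤ K * ε := by
  filter_upwards [hC.bounded t] with ω h
  rw [abs_mul, mul_comm K]
  exact mul_le_mul h (hC.taylor.abs_E _ _) (abs_nonneg _) hC.nonneg

lemma abs_mul_W_le (t : ℤ) (i : Fin d) :
    ∀ᵐ ω ∂μ, |ζ t ω ^ 2 * (1 / 2 * W (S.X t ω) i)| ≤ K * ε ^ 2 := by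
  filter_upwards [hC.bounded t] with ω h
  rw [abs_mul, abs_pow, mul_comm K, abs_mul, abs_of_pos (by norm_num : (0 : ℝ) < 1 / 2)]
  refine mul_le_mul (pow_le_pow_left₀ (abs_nonneg _) h 2) ?_ (by positivity)
    (pow_nonneg hC.nonneg 2)
  linarith [hC.taylor.abs_W (S.X t ω) i, abs_nonneg (W (S.X t ω) i)]

/-- Rows of `P 0 ^ n` are probability vectors, so the entries are averages of those of `M`; hence
uniformity in `n`. -/
lemma abs_pow_mul_le {M : Matrix (Fin d) (Fin d) ℝ} (hM : ∀ i j, |M i j| ≤ K) (n : ℕ)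
    (i j : Fin d) : |(P 0 ^ n * M) i j| ≤ K := by
  have hn := Submonoid.pow_mem _ (hC.stochastic 0) n
  refine (abs_sum_mul_le (v := fun k => (P 0 ^ n) i k) fun k => hM k j).trans_eq ?_
  have : l1 (fun k => (P 0 ^ n) i k) = 1 := by
    rw [← sum_row_of_mem_rowStochastic hn i]
    exact Finset.sum_congr rfl fun k _ => abs_of_nonneg (nonneg_of_mem_rowStochastic hn)
  rw [this, one_mul]

lemma essBdd_ζ_history (s t : ℤ) : EssBdd (S.history t) μ (ζ s) :=
  (hC.essBdd_ζ s).mono (S.procSigma_le_history t)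

lemma essBdd_ζ_sq (t : ℤ) : EssBdd (procSigma ζ) μ fun ω => ζ t ω ^ 2 := by
  simpa only [pow_two] using (hC.essBdd_ζ t).mul (hC.essBdd_ζ t)

lemma essBdd_mul_E {s t : ℤ} (h : s ≤ t) (i : Fin d) :
    EssBdd (S.history t) μ fun ω => ζ s ω * E (S.X s ω) i :=
  (hC.essBdd_ζ_history S s t).mul (S.essBdd_matrix_X E h i)

lemma essBdd_mul_W {s t : ℤ} (h : s ≤ t) (i : Fin d) :
    EssBdd (S.history t) μ fun ω => ζ s ω ^ 2 * (1 / 2 * W (S.X s ω) i) :=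
  ((hC.essBdd_ζ_sq s).mono (S.procSigma_le_history t)).mul
    ((S.essBdd_matrix_X W h i).const_mul (1 / 2))

lemma abs_ζ_mul_ζ_le (s t : ℤ) : ∀ᵐ ω ∂μ, |ζ s ω * ζ t ω| ≤ ε ^ 2 := by
  filter_upwards [hC.bounded s, hC.bounded t] with ω h1 h2
  rw [abs_mul, pow_two]
  exact mul_le_mul h1 h2 (abs_nonneg _) hC.nonneg

lemma abs_ζ_sq_le (t : ℤ) : ∀ᵐ ω ∂μ, |ζ t ω ^ 2| ≤ ε ^ 2 := by
  simpa only [pow_two] using hC.abs_ζ_mul_ζ_le t t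

variable [IsProbabilityMeasure μ]

lemma integral_ζ_mul_ζ (S : StationarySolution P μ ζ 𝒩) (s t : ℤ) : ∫ ω, ζ s ω * ζ t ω ∂μ = autoCorr μ ζ (s - t) := by
  have := S.integral_shift hC.measurable (s - t) 0 t (Φ := fun p => p.1.2.1 * p.2.2.1)
    (by fun_prop)
  simpa [StationarySolution.triple, autoCorr] using this

theorem R_Δ_eq_zero {t : ℤ} (ht : t ≠ 0) : S.R_Δ t = 0 := by
  ext i j
  simp only [StationarySolution.R_Δ, crossMoment, of_apply, Matrix.zero_apply]
  rcases lt_or_gt_of_ne ht with h | h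
  · exact S.integral_mul_Δ hC.measurable h (S.essBdd_Δ hC.measurable le_rfl i) j
  · simp only [mul_comm (S.Δ t _ i)]
    exact S.integral_mul_Δ hC.measurable h (S.essBdd_Δ hC.measurable le_rfl j) i

theorem R_BζΔ_eq_zero {t : ℤ} (ht : t < 0) : S.R_BζΔ t = 0 := by
  ext i j
  rw [hC.R_BζΔ_apply]
  exact S.integral_mul_Δ hC.measurable ht (hC.essBdd_mul_E S le_rfl i) j

theorem R_VζζΔ_eq_zero {t : ℤ} (ht : t < 0) : S.R_VζζΔ t = 0 := by
  ext i j
  rw [hC.R_VζζΔ_apply]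
  exact S.integral_mul_Δ hC.measurable ht (hC.essBdd_mul_W S le_rfl i) j

/-- The innovation term vanishes for every `t`, because `ζ_0` belongs to the history at `t - 1` even
when it lies in the future. The quadratic term is already cubic in `ε` after multiplication by
`ζ_0`. -/
theorem abs_R_Dζ_sub_le (t : ℤ) (i : Fin d) :
    |S.R_Dζ t i - (π₀ ᵥ* E) i * autoCorr μ ζ (t - 1)| ≤ (κ * d * K * K + K) * ε ^ 3 := by
  have hle := S.history_le hC.measurable t
  have h0 := hC.essBdd_ζ_history S 0 t
  have x := (hC.essBdd_mul_E S (s := t - 1) (t := t) (by omega) i).mul h0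
  have y := (hC.essBdd_mul_W S (s := t - 1) (t := t) (by omega) i).mul h0
  have z := h0.mul (S.essBdd_Δ hC.measurable (le_refl t) i)
  have hZ := (hC.essBdd_ζ (t - 1)).mul (hC.essBdd_ζ 0)
  have e : S.R_Dζ t i = ∫ ω, ζ (t - 1) ω * E (S.X (t - 1) ω) i * ζ 0 ω ∂μ
      + ∫ ω, ζ (t - 1) ω ^ 2 * (1 / 2 * W (S.X (t - 1) ω) i) * ζ 0 ω ∂μ
      + ∫ ω, ζ 0 ω * S.Δ t ω i ∂μ := by
    rw [← integral_add (x.integrable hle) (y.integrable hle),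
      ← integral_add ((x.add y).integrable hle) (z.integrable hle)]
    refine integral_congr_ae (Filter.Eventually.of_forall fun ω => ?_)
    simp only [hC.D_apply]
    ring
  have e1 : ∫ ω, ζ (t - 1) ω * E (S.X (t - 1) ω) i * ζ 0 ω ∂μ
      = (S.moment (t - 1) (fun ω => ζ (t - 1) ω * ζ 0 ω) ᵥ* E) i := by
    rw [S.moment_vecMul (hZ.mono (procSigma_le ζ hC.measurable))]
    simp only [mul_right_comm]
  have e3 : ∫ ω, ζ 0 ω * S.Δ t ω i ∂μ = 0 :=
    S.integral_mul_Δ hC.measurable (s := t - 1) (by omega) (hC.essBdd_ζ_history S _ _) i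
  have b1 := (abs_vecMul_le hC.taylor.abs_E i).trans (mul_le_mul_of_nonneg_right
    (hC.l1_moment_sub_invariant_le S hZ (hC.abs_ζ_mul_ζ_le _ _) (t - 1)) hC.K_nonneg)
  rw [hC.integral_ζ_mul_ζ S, sub_zero, sub_vecMul, smul_vecMul] at b1
  have b2 : |∫ ω, ζ (t - 1) ω ^ 2 * (1 / 2 * W (S.X (t - 1) ω) i) * ζ 0 ω ∂μ|
      ≤ K * ε ^ 2 * ε := by
    refine abs_integral_le_of_ae ?_
    filter_upwards [hC.abs_mul_W_le S (t - 1) i, hC.bounded 0] with ω h1 h2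
    rw [abs_mul]
    exact mul_le_mul h1 h2 (abs_nonneg _) ((abs_nonneg _).trans h1)
  rw [e, e1, e3]
  simp only [Pi.sub_apply, Pi.smul_apply, smul_eq_mul] at b1
  rw [abs_le] at b1 b2 ⊢
  constructor <;> linarith [b1.1, b1.2, b2.1, b2.2]

theorem entriesLE_R_D_sub (t : ℤ) : EntriesLE
    (S.R_D t - (S.R_Bζ t + S.R_Δ t + (S.R_BζΔ (t - 1) + (S.R_BζΔ (-t - 1))ᵀ)
      + (S.R_VζζΔ (t - 1) + (S.R_VζζΔ (-t - 1))ᵀ))) (3 * K ^ 2 * ε ^ 3) := by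
  intro i j
  set x : ℤ → Fin d → Ω → ℝ := fun t i ω => ζ t ω * E (S.X t ω) i
  set y : ℤ → Fin d → Ω → ℝ := fun t i ω => ζ t ω ^ 2 * (1 / 2 * W (S.X t ω) i)
  have hx : ∀ t i, EssBdd m₀ μ (x t i) := fun t i =>
    (hC.essBdd_mul_E S le_rfl i).mono (S.history_le hC.measurable t)
  have hy : ∀ t i, EssBdd m₀ μ (y t i) := fun t i =>
    (hC.essBdd_mul_W S le_rfl i).mono (S.history_le hC.measurable t)
  have hz : ∀ t i, EssBdd m₀ μ fun ω => S.Δ t ω i := fun t i =>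
    (S.essBdd_Δ hC.measurable le_rfl i).mono (S.history_le hC.measurable t)
  -- `D_t` and `D_0` involve the disturbance at times `t - 1` and `-1`; stationarity brings the
  -- correlations to these times.
  have s1 : S.R_Bζ t i j = ∫ ω, x (t - 1) i ω * x (-1) j ω ∂μ := by
    rw [hC.R_Bζ_apply]
    have := S.integral_shift hC.measurable t 0 (-1)
      (Φ := fun p => (p.1.2.1 * (p.1.1 ᵥ* E) i) * (p.2.2.1 * (p.2.1 ᵥ* E) j)) (by
        simp only [vecMul, dotProduct]; fun_prop)
    simp only [StationarySolution.triple, S.Γ_vecMul, zero_add] at this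
    simp only [S.sum_Γ_mul _ _ fun k => E k i, S.sum_Γ_mul _ _ fun k => E k j] at this
    exact this.symm
  have s2 : (S.R_BζΔ (-t - 1))ᵀ i j = ∫ ω, S.Δ t ω i * x (-1) j ω ∂μ := by
    rw [transpose_apply, hC.R_BζΔ_apply]
    have := S.integral_shift hC.measurable (-t - 1) 0 t
      (Φ := fun p => (p.1.2.1 * (p.1.1 ᵥ* E) j) * p.2.2.2 i) (by
        simp only [vecMul, dotProduct]; fun_prop)
    simp only [StationarySolution.triple, S.Γ_vecMul, zero_add] at this
    simp only [S.sum_Γ_mul _ _ fun k => E k j] at this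
    rw [← this]
    simp only [show -t - 1 + t = -1 by ring, mul_comm (S.Δ t _ i), x]
  have s3 : (S.R_VζζΔ (-t - 1))ᵀ i j = ∫ ω, S.Δ t ω i * y (-1) j ω ∂μ := by
    rw [transpose_apply, hC.R_VζζΔ_apply]
    have := S.integral_shift hC.measurable (-t - 1) 0 t
      (Φ := fun p => (p.1.2.1 ^ 2 * (1 / 2 * (p.1.1 ᵥ* W) j)) * p.2.2.2 i) (by
        simp only [vecMul, dotProduct]; fun_prop)
    simp only [StationarySolution.triple, S.Γ_vecMul, zero_add] at this
    simp only [S.sum_Γ_mul _ _ fun k => W k j] at this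
    rw [← this]
    simp only [show -t - 1 + t = -1 by ring, mul_comm (S.Δ t _ i), y]
  have s4 : S.R_BζΔ (t - 1) i j = ∫ ω, x (t - 1) i ω * S.Δ 0 ω j ∂μ := hC.R_BζΔ_apply S _ i j
  have s5 : S.R_VζζΔ (t - 1) i j = ∫ ω, y (t - 1) i ω * S.Δ 0 ω j ∂μ := hC.R_VζζΔ_apply S _ i j
  have s6 : S.R_Δ t i j = ∫ ω, S.Δ t ω i * S.Δ 0 ω j ∂μ := rfl
  -- Of the nine products in `D_tᵀ D_0`, these three contain at least three factors of `ζ` and form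
  -- the remainder.
  have hr : EssBdd m₀ μ fun ω => x (t - 1) i ω * y (-1) j ω
      + (y (t - 1) i ω * x (-1) j ω + y (t - 1) i ω * y (-1) j ω) :=
    ((hx _ _).mul (hy _ _)).add (((hy _ _).mul (hx _ _)).add ((hy _ _).mul (hy _ _)))
  have hxx := (hx (t - 1) i).mul (hx (-1) j)
  have hzz := (hz t i).mul (hz 0 j)
  have hxz := (hx (t - 1) i).mul (hz 0 j)
  have hzx := (hz t i).mul (hx (-1) j)
  have hyz := (hy (t - 1) i).mul (hz 0 j)
  have hzy := (hz t i).mul (hy (-1) j)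
  have e : S.R_D t i j = S.R_Bζ t i j + S.R_Δ t i j
      + (S.R_BζΔ (t - 1) i j + (S.R_BζΔ (-t - 1))ᵀ i j)
      + (S.R_VζζΔ (t - 1) i j + (S.R_VζζΔ (-t - 1))ᵀ i j)
      + ∫ ω, (x (t - 1) i ω * y (-1) j ω
        + (y (t - 1) i ω * x (-1) j ω + y (t - 1) i ω * y (-1) j ω)) ∂μ := by
    rw [s1, s2, s3, s4, s5, s6, ← integral_add (hxx.integrable le_rfl) (hzz.integrable le_rfl),
      ← integral_add (hxz.integrable le_rfl) (hzx.integrable le_rfl),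
      ← integral_add (hyz.integrable le_rfl) (hzy.integrable le_rfl),
      ← integral_add ((hxx.add hzz).integrable le_rfl) ((hxz.add hzx).integrable le_rfl),
      ← integral_add (((hxx.add hzz).add (hxz.add hzx)).integrable le_rfl)
        ((hyz.add hzy).integrable le_rfl),
      ← integral_add ((((hxx.add hzz).add (hxz.add hzx)).add (hyz.add hzy)).integrable le_rfl)
        (hr.integrable le_rfl)]
    refine integral_congr_ae (Filter.Eventually.of_forall fun ω => ?_)
    simp only [hC.D_apply, zero_sub, x, y]
    ring
  simp only [Matrix.sub_apply, Matrix.add_apply, e, add_sub_cancel_left]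
  refine abs_integral_le_of_ae ?_
  filter_upwards [hC.abs_mul_E_le S (t - 1) i, hC.abs_mul_E_le S (-1) j,
    hC.abs_mul_W_le S (t - 1) i, hC.abs_mul_W_le S (-1) j] with ω h1 h2 h3 h4
  have hK := hC.K_nonneg
  have hε := hC.nonneg
  have h5 : K * ε ^ 2 ≤ K * ε := mul_le_mul_of_nonneg_left
    (pow_le_of_le_one hε hC.le_one two_ne_zero) hK
  refine (abs_add_le _ _).trans ((add_le_add_right (abs_add_le _ _) _).trans ?_)
  simp only [abs_mul (x _ _ _), abs_mul (y _ _ _)]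
  have b1 := mul_le_mul h1 h4 (abs_nonneg _) (by positivity)
  have b2 := mul_le_mul h3 h2 (abs_nonneg _) (by positivity)
  have b3 := mul_le_mul (h3.trans h5) h4 (abs_nonneg _) (by positivity)
  calc _ ≤ _ := add_le_add b1 (add_le_add b2 b3)
    _ = _ := by ring

theorem entriesLE_R_Bζ_sub (n : ℕ) : EntriesLE
    (S.R_Bζ n - autoCorr μ ζ n • ((P 0 ^ n * E)ᵀ * diagonal π₀ * E))
    (2 * (κ * d * K * K ^ 2) * ε ^ 3) := by
  intro i j
  have hK := hC.K_nonneg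
  have hε := hC.nonneg
  have hle := S.history_le hC.measurable 0
  -- `U`, of size `ε²`, is known at time zero although it involves `ζ_n`. The chain is first moved
  -- from time `n` back to zero by `P 0 ^ n`, then its law at zero is replaced by `π₀`.
  set U : Ω → ℝ := fun ω => ζ n ω * (ζ 0 ω * E (S.X 0 ω) j)
  have hU : EssBdd (S.history 0) μ U :=
    (hC.essBdd_ζ_history S n 0).mul (hC.essBdd_mul_E S le_rfl j)
  have hU0 := hU.mono hle
  have hUc : ∀ᵐ ω ∂μ, |U ω| ≤ ε * (K * ε) := by
    filter_upwards [hC.bounded n, hC.abs_mul_E_le S 0 j] with ω h1 h2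
    rw [abs_mul]
    exact mul_le_mul h1 h2 (abs_nonneg _) hC.nonneg
  have e1 : S.R_Bζ n i j = (S.moment n U ᵥ* E) i := by
    rw [hC.R_Bζ_apply, S.moment_vecMul hU0]
    refine integral_congr_ae (Filter.Eventually.of_forall fun ω => ?_)
    simp only [U]
    ring
  have b1 := (abs_vecMul_le hC.taylor.abs_E i).trans (mul_le_mul_of_nonneg_right
    (hC.l1_moment_sub_pow_le S hU hUc n) hK)
  rw [sub_vecMul, vecMul_vecMul, Pi.sub_apply, ← e1, S.moment_vecMul hU0] at b1
  have hZ := (hC.essBdd_ζ n).mul (hC.essBdd_ζ 0)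
  have e2 : ∫ ω, U ω * (P 0 ^ n * E) (S.X 0 ω) i ∂μ
      = ∑ k, S.moment 0 (fun ω => ζ n ω * ζ 0 ω) k * (E k j * (P 0 ^ n * E) k i) := by
    rw [S.sum_moment (hZ.mono (procSigma_le ζ hC.measurable)) 0
      fun k => E k j * (P 0 ^ n * E) k i]
    refine integral_congr_ae (Filter.Eventually.of_forall fun ω => ?_)
    simp only [U]
    ring
  have b2 : |∑ k, (S.moment 0 (fun ω => ζ n ω * ζ 0 ω) - (∫ ω, ζ n ω * ζ 0 ω ∂μ) • π₀) k
      * (E k j * (P 0 ^ n * E) k i)| ≤ κ * d * K * (ε ^ 2 * ε) * (K * K) := by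
    refine (abs_sum_mul_le (K := K * K) fun k => ?_).trans (mul_le_mul_of_nonneg_right
      (hC.l1_moment_sub_invariant_le S hZ (hC.abs_ζ_mul_ζ_le _ _) 0) (by positivity))
    rw [abs_mul]
    exact mul_le_mul (hC.taylor.abs_E _ _) (hC.abs_pow_mul_le hC.taylor.abs_E n k i)
      (abs_nonneg _) hK
  have e3 : (autoCorr μ ζ n • ((P 0 ^ n * E)ᵀ * diagonal π₀ * E)) i j
      = ∑ k, ((∫ ω, ζ n ω * ζ 0 ω ∂μ) • π₀) k * (E k j * (P 0 ^ n * E) k i) := by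
    rw [Matrix.smul_apply, transpose_mul_diagonal_mul_apply, smul_eq_mul, Finset.mul_sum]
    refine Finset.sum_congr rfl fun k _ => ?_
    simp only [autoCorr, Pi.smul_apply, smul_eq_mul]
    ring
  simp only [Pi.sub_apply, sub_mul, Finset.sum_sub_distrib] at b2
  rw [← e2, ← e3] at b2
  rw [Matrix.sub_apply]
  rw [abs_le] at b1 b2 ⊢
  constructor <;> linarith [b1.1, b1.2, b2.1, b2.2]

end SmallDisturbance


/-! ### Covariance of the innovations and their correlation with the disturbance terms. -/

/-- Second-order expansion of a product. -/
lemma abs_mul_sub_expansion_le {a a' e e' w w' p p' z ε K : ℝ} (hK : 0 ≤ K)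
    (hε1 : ε ≤ 1) (hz : |z| ≤ ε) (hp : |p| ≤ 1) (hp' : |p'| ≤ 1)
    (he : |e| ≤ K) (he' : |e'| ≤ K) (hw : |w| ≤ K) (hw' : |w'| ≤ K)
    (h : |p - a - z * e - z ^ 2 * (1 / 2 * w)| ≤ K * ε ^ 3)
    (h' : |p' - a' - z * e' - z ^ 2 * (1 / 2 * w')| ≤ K * ε ^ 3) :
    |p * p' - (a * a' + z * (a * e' + e * a')
      + z ^ 2 * (1 / 2 * (a * w' + 2 * (e * e') + w * a')))| ≤ (2 * K + 3 * K ^ 2) * ε ^ 3 := by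
  have hε : 0 ≤ ε := (abs_nonneg z).trans hz
  set r := p - a - z * e - z ^ 2 * (1 / 2 * w)
  set r' := p' - a' - z * e' - z ^ 2 * (1 / 2 * w')
  -- Writing the cross terms as `r p' + p r' - r r'` allows the bounds `|p|, |p'| ≤ 1` to be used
  -- instead of bounds on the Taylor polynomials.
  have e1 : p * p' - (a * a' + z * (a * e' + e * a')
      + z ^ 2 * (1 / 2 * (a * w' + 2 * (e * e') + w * a')))
      = r * p' + p * r' - r * r' + z ^ 3 * (1 / 2 * (e * w' + w * e') + z * (1 / 4 * (w * w'))) := by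
    simp only [r, r']; ring
  have hε3 : 0 ≤ ε ^ 3 := pow_nonneg hε 3
  have b1 : |r * p'| ≤ K * ε ^ 3 := by
    rw [abs_mul]; exact (mul_le_of_le_one_right (abs_nonneg _) hp').trans h
  have b2 : |p * r'| ≤ K * ε ^ 3 := by
    rw [abs_mul]; exact (mul_le_of_le_one_left (abs_nonneg _) hp).trans h'
  have b3 : |r * r'| ≤ K ^ 2 * ε ^ 3 := by
    rw [abs_mul]
    have h1 : ε ^ 3 ≤ 1 := pow_le_one₀ hε hε1
    calc |r| * |r'| ≤ (K * ε ^ 3) * (K * 1) := mul_le_mul h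
          (h'.trans (mul_le_mul_of_nonneg_left h1 hK)) (abs_nonneg _) (by positivity)
      _ = K ^ 2 * ε ^ 3 := by ring
  have hew : |e * w'| ≤ K ^ 2 := by
    rw [abs_mul, pow_two]; exact mul_le_mul he hw' (abs_nonneg _) hK
  have hwe : |w * e'| ≤ K ^ 2 := by
    rw [abs_mul, pow_two]; exact mul_le_mul hw he' (abs_nonneg _) hK
  have hww : |w * w'| ≤ K ^ 2 := by
    rw [abs_mul, pow_two]; exact mul_le_mul hw hw' (abs_nonneg _) hK
  have hzw : |z * (1 / 4 * (w * w'))| ≤ 1 / 4 * K ^ 2 := by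
    rw [abs_mul, abs_mul (1 / 4), abs_of_pos (by norm_num : (0 : ℝ) < 1 / 4)]
    calc |z| * (1 / 4 * |w * w'|) ≤ 1 * (1 / 4 * K ^ 2) :=
          mul_le_mul (hz.trans hε1) (by linarith) (by positivity) zero_le_one
      _ = 1 / 4 * K ^ 2 := one_mul _
  have b4 : |z ^ 3 * (1 / 2 * (e * w' + w * e') + z * (1 / 4 * (w * w')))|
      ≤ ε ^ 3 * (2 * K ^ 2) := by
    rw [abs_mul, abs_pow]
    refine mul_le_mul (pow_le_pow_left₀ (abs_nonneg _) hz 3) ?_ (abs_nonneg _) hε3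
    rw [abs_le] at hew hwe hzw ⊢
    constructor <;> linarith [hew.1, hew.2, hwe.1, hwe.2, hzw.1, hzw.2, sq_nonneg K]
  rw [e1]
  clear_value r r'
  rw [abs_le] at b1 b2 b3 b4 ⊢
  constructor <;> linarith [b1.1, b1.2, b2.1, b2.2, b3.1, b3.2, b4.1, b4.2]

namespace SmallDisturbance

variable {Ω : Type*} [m₀ : MeasurableSpace Ω] {d : ℕ} {P : ℝ → Matrix (Fin d) (Fin d) ℝ}
  {μ : Measure Ω} [IsProbabilityMeasure μ] {ζ : ℤ → Ω → ℝ} {𝒩 : Type*} [MeasurableSpace 𝒩]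
  {π₀ : Fin d → ℝ} {E W : Matrix (Fin d) (Fin d) ℝ} {κ K δ ε : ℝ}
  (hC : SmallDisturbance P π₀ E W κ K δ ε μ ζ) (S : StationarySolution P μ ζ 𝒩)

include hC

theorem entriesLE_R_Δ_zero_sub : EntriesLE
    (S.R_Δ 0 - (diagonal S.mean - (P 0)ᵀ * diagonal S.mean * P 0
      - ((P 0)ᵀ * diagonal (S.R_Γζ 0) * E + Eᵀ * diagonal (S.R_Γζ 0) * P 0)
      - ((1 / 2 : ℝ) * autoCorr μ ζ 0) •
        ((P 0)ᵀ * diagonal π₀ * W + (2 : ℝ) • (Eᵀ * diagonal π₀ * E)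
          + Wᵀ * diagonal π₀ * P 0)))
    ((κ * d * K * (K + K ^ 2) + (2 * K + 3 * K ^ 2)) * ε ^ 3) := by
  intro i j
  have hK := hC.K_nonneg
  have hε := hC.nonneg
  have hle := S.history_le hC.measurable (-1)
  have hm := procSigma_le ζ hC.measurable
  -- Coefficients of `1`, `z` and `z ^ 2` in the product of two entries of `P z`. Only the moment
  -- paired with `f₂` is replaced by its `π₀` limit, since its weight is of order `ε²`.
  let f₀ : Fin d → ℝ := fun k => P 0 k i * P 0 k j
  let f₁ : Fin d → ℝ := fun k => P 0 k i * E k j + E k i * P 0 k j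
  let f₂ : Fin d → ℝ := fun k =>
    1 / 2 * (P 0 k i * W k j + 2 * (E k i * E k j) + W k i * P 0 k j)
  have h1 : EssBdd (procSigma ζ) μ fun _ => (1 : ℝ) := EssBdd.const 1
  have hz := hC.essBdd_ζ (-1)
  have hzz := hC.essBdd_ζ_sq (-1)
  have mean_eq : ∀ t, S.moment t (fun _ => 1) = S.mean := by
    intro t
    ext k
    have := S.integral_shift hC.measurable 0 0 t (Φ := fun p => p.1.1 k) (by fun_prop)
    simpa [StationarySolution.triple, StationarySolution.moment, StationarySolution.mean] using this
  have cov_eq : S.moment (-1) (ζ (-1)) = S.R_Γζ 0 := by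
    ext k
    have := S.integral_shift hC.measurable 0 0 (-1) (Φ := fun p => p.1.1 k * p.1.2.1) (by fun_prop)
    simp only [StationarySolution.triple, zero_add] at this
    simpa only [StationarySolution.moment, StationarySolution.R_Γζ, mul_comm (ζ (-1) _)] using this
  have e := hC.integral_Δ_mul_Δ S h1 (-1) i j
  simp only [one_mul, neg_add_cancel, mean_eq] at e
  have eR : S.R_Δ 0 i j = ∫ ω, S.Δ 0 ω i * S.Δ 0 ω j ∂μ := rfl
  have g : ∀ f : Fin d → ℝ, EssBdd (S.history (-1)) μ fun ω => f (S.X (-1) ω) := fun f =>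
    S.essBdd_matrix_X (Matrix.of fun k _ => f k) le_rfl i
  have hpp := ((S.essBdd_P_X hC.measurable (le_refl (-1)) i).mul
    (S.essBdd_P_X hC.measurable (le_refl (-1)) j)).integrable hle
  have g0 := (((h1.mono (S.procSigma_le_history (-1))).mul (g f₀))).integrable hle
  have g1 := (((hz.mono (S.procSigma_le_history (-1))).mul (g f₁))).integrable hle
  have g2 := (((hzz.mono (S.procSigma_le_history (-1))).mul (g f₂))).integrable hle
  have g01 : Integrable (fun ω => 1 * f₀ (S.X (-1) ω) + ζ (-1) ω * f₁ (S.X (-1) ω)) μ := g0.add g1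
  have g012 : Integrable (fun ω => 1 * f₀ (S.X (-1) ω) + ζ (-1) ω * f₁ (S.X (-1) ω)
    + ζ (-1) ω ^ 2 * f₂ (S.X (-1) ω)) μ := g01.add g2
  have b1 : |∫ ω, P (ζ (-1) ω) (S.X (-1) ω) i * P (ζ (-1) ω) (S.X (-1) ω) j ∂μ
      - (∑ k, S.mean k * f₀ k + ∑ k, S.R_Γζ 0 k * f₁ k
        + ∑ k, S.moment (-1) (fun ω => ζ (-1) ω ^ 2) k * f₂ k)|
      ≤ (2 * K + 3 * K ^ 2) * ε ^ 3 := by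
    rw [← mean_eq (-1), ← cov_eq, S.sum_moment (h1.mono hm), S.sum_moment (hz.mono hm),
      S.sum_moment (hzz.mono hm), ← integral_add g0 g1, ← integral_add g01 g2,
      ← integral_sub hpp g012]
    refine abs_integral_le_of_ae ?_
    filter_upwards [hC.bounded (-1), hC.order_three (-1)] with ω h1 h2
    have := abs_mul_sub_expansion_le hK hC.le_one h1
      (hC.abs_P_le_one (ζ (-1) ω) (S.X (-1) ω) i) (hC.abs_P_le_one (ζ (-1) ω) (S.X (-1) ω) j)
      (hC.taylor.abs_E (S.X (-1) ω) i) (hC.taylor.abs_E (S.X (-1) ω) j)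
      (hC.taylor.abs_W (S.X (-1) ω) i) (hC.taylor.abs_W (S.X (-1) ω) j)
      (h2 (S.X (-1) ω) i) (h2 (S.X (-1) ω) j)
    simpa only [one_mul, f₀, f₁, f₂] using this
  have hf₂ : ∀ k, |f₂ k| ≤ K + K ^ 2 := by
    intro k
    have a1 : |P 0 k i * W k j| ≤ K := by
      rw [abs_mul]
      exact (mul_le_of_le_one_left (abs_nonneg _) (hC.abs_P_le_one 0 k i)).trans
        (hC.taylor.abs_W k j)
    have a2 : |W k i * P 0 k j| ≤ K := by
      rw [abs_mul]
      exact (mul_le_of_le_one_right (abs_nonneg _) (hC.abs_P_le_one 0 k j)).trans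
        (hC.taylor.abs_W k i)
    have a3 : |E k i * E k j| ≤ K ^ 2 := by
      rw [abs_mul, pow_two]
      exact mul_le_mul (hC.taylor.abs_E k i) (hC.taylor.abs_E k j) (abs_nonneg _) hK
    simp only [f₂]
    rw [abs_le] at a1 a2 a3 ⊢
    constructor <;> linarith [a1.1, a1.2, a2.1, a2.2, a3.1, a3.2]
  have b2 := (abs_sum_mul_le (v := S.moment (-1) (fun ω => ζ (-1) ω ^ 2)
    - (∫ ω, ζ (-1) ω ^ 2 ∂μ) • π₀) hf₂).trans (mul_le_mul_of_nonneg_right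
    (hC.l1_moment_sub_invariant_le S hzz (hC.abs_ζ_sq_le (-1)) (-1)) (by positivity))
  have var_eq : ∫ ω, ζ (-1) ω ^ 2 ∂μ = autoCorr μ ζ 0 := by
    simpa only [pow_two, sub_self] using hC.integral_ζ_mul_ζ S (-1) (-1)
  simp only [var_eq, Pi.sub_apply, Pi.smul_apply, smul_eq_mul, sub_mul,
    Finset.sum_sub_distrib] at b2
  have c1 : ((P 0)ᵀ * diagonal (S.R_Γζ 0) * E + Eᵀ * diagonal (S.R_Γζ 0) * P 0) i j
      = ∑ k, S.R_Γζ 0 k * f₁ k := by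
    simp only [Matrix.add_apply, transpose_mul_diagonal_mul_apply, f₁, mul_add,
      Finset.sum_add_distrib]
  have c2 : (((1 / 2 : ℝ) * autoCorr μ ζ 0) • ((P 0)ᵀ * diagonal π₀ * W
      + (2 : ℝ) • (Eᵀ * diagonal π₀ * E) + Wᵀ * diagonal π₀ * P 0)) i j
      = ∑ k, autoCorr μ ζ 0 * π₀ k * f₂ k := by
    simp only [Matrix.smul_apply, Matrix.add_apply, transpose_mul_diagonal_mul_apply, f₂,
      smul_eq_mul, Finset.mul_sum, ← Finset.sum_add_distrib]
    exact Finset.sum_congr rfl fun k _ => by ring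
  rw [Matrix.sub_apply, Matrix.sub_apply, Matrix.sub_apply, Matrix.sub_apply, c1, c2,
    transpose_mul_diagonal_mul_apply, diagonal_apply, eR, e]
  simp only [f₀] at b1
  rw [abs_le] at b1 b2 ⊢
  constructor <;> linarith [b1.1, b1.2, b2.1, b2.2]

lemma moment_mul_Δ_eq {Z : Ω → ℝ} (hZ : EssBdd (procSigma ζ) μ Z) (j k : Fin d) :
    S.moment 0 (fun ω => Z ω * S.Δ 0 ω j) k = ∫ ω, S.Δ 0 ω k * S.Δ 0 ω j * Z ω ∂μ := by
  rw [hC.moment_Δ_mul S hZ]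
  exact integral_congr_ae (Filter.Eventually.of_forall fun ω => by ring)

theorem R_BζΔ_zero : S.R_BζΔ 0 = Eᵀ * S.R_ΔΔζ 0 := by
  ext i j
  have hU := (hC.essBdd_ζ_history S 0 0).mul (S.essBdd_Δ hC.measurable le_rfl j)
  rw [hC.R_BζΔ_apply, transpose_mul_apply_eq_vecMul]
  have : (fun k => S.R_ΔΔζ 0 k j) = S.moment 0 fun ω => ζ 0 ω * S.Δ 0 ω j :=
    funext fun k => (hC.moment_mul_Δ_eq S (hC.essBdd_ζ 0) j k).symm
  rw [this, S.moment_vecMul (hU.mono (S.history_le hC.measurable 0))]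
  exact integral_congr_ae (Filter.Eventually.of_forall fun ω => by ring)

/-- The moments of the innovation at time zero against the chain, up to `O(ε)`. -/
lemma l1_moment_mul_Δ_sub_le {Z : Ω → ℝ} (hZ : EssBdd (procSigma ζ) μ Z) {c : ℝ}
    (hc : ∀ᵐ ω ∂μ, |Z ω| ≤ c) (j : Fin d) :
    l1 (S.moment 0 (fun ω => Z ω * S.Δ 0 ω j)
      - (∫ ω, Z ω ∂μ) • fun k => sigmaBullet (P 0) π₀ k j)
      ≤ d * ((2 * (κ * d * K) + 2 * K) * (c * ε)) := by
  refine l1_le_of_abs_le fun k => ?_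
  rw [Pi.sub_apply, hC.moment_Δ_mul S hZ, Pi.smul_apply, smul_eq_mul]
  exact hC.abs_integral_Δ_mul_Δ_sub_le S hZ hc 0 k j

/-- The weight `ζ_n Δ_0` is only of order `ε`, so the second-order law is required. Its correction
at step `m` has weight `ζ_n ζ_m Δ_0`, whose leading moment is `R_ζ(n - m)` times a column of `Σ`. -/
theorem entriesLE_R_BζΔ_sub (n : ℕ) : EntriesLE
    (S.R_BζΔ n - (Eᵀ * (P 0)ᵀ ^ n * S.R_ΔΔζ (-n)
      + Eᵀ * ∑ i ∈ Finset.range n, autoCorr μ ζ ((n : ℤ) - i) •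
        ((P 0)ᵀ ^ (n - 1 - i) * Eᵀ * (P 0)ᵀ ^ i * sigmaBullet (P 0) π₀)))
    (κ * (d * K + d * K * (κ * d * K) + d * K * (d * (2 * (κ * d * K) + 2 * K))) * K
      * ε ^ 3) := by
  intro i j
  set Sig := sigmaBullet (P 0) π₀
  have hle := S.history_le hC.measurable 0
  set U : Ω → ℝ := fun ω => ζ n ω * S.Δ 0 ω j
  have hU : EssBdd (S.history 0) μ U :=
    (hC.essBdd_ζ_history S n 0).mul (S.essBdd_Δ hC.measurable le_rfl j)
  have hUc : ∀ᵐ ω ∂μ, |U ω| ≤ ε := by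
    filter_upwards [hC.bounded n, hC.abs_Δ_le S 0 j] with ω h1 h2
    rw [abs_mul, ← mul_one ε]
    exact mul_le_mul h1 h2 (abs_nonneg _) hC.nonneg
  let q : ℕ → Fin d → ℝ := fun m => autoCorr μ ζ ((n : ℤ) - m) • fun k => Sig k j
  -- Variation of constants: the explicit solution of the recursion with forcing `q m P_0^m E`.
  let w : ℕ → Fin d → ℝ := fun m => S.moment 0 U ᵥ* P 0 ^ m
    + ∑ i ∈ Finset.range m, q i ᵥ* (P 0 ^ i * E * P 0 ^ (m - 1 - i))
  have hw : ∀ m, w (m + 1) = w m ᵥ* P 0 + (q m ᵥ* P 0 ^ m) ᵥ* E := by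
    intro m
    simp only [w]
    rw [Finset.sum_range_succ, add_vecMul, vecMul_vecMul, ← pow_succ, Matrix.sum_vecMul, vecMul_vecMul,
      add_assoc]
    congr 2
    · refine Finset.sum_congr rfl fun i hi => ?_
      have : m + 1 - 1 - i = m - 1 - i + 1 := by have := Finset.mem_range.1 hi; omega
      rw [vecMul_vecMul, this, pow_succ]
      simp only [Matrix.mul_assoc]
    · simp
  have hq : ∀ m : ℕ, l1 (S.moment 0 (fun ω => U ω * ζ m ω) - q m)
      ≤ d * ((2 * (κ * d * K) + 2 * K) * (ε ^ 2 * ε)) := by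
    intro m
    have := hC.l1_moment_mul_Δ_sub_le S ((hC.essBdd_ζ n).mul (hC.essBdd_ζ m))
      (hC.abs_ζ_mul_ζ_le n m) j
    rw [hC.integral_ζ_mul_ζ S] at this
    simpa only [U, q, mul_right_comm] using this
  have b := (abs_vecMul_le hC.taylor.abs_E i).trans (mul_le_mul_of_nonneg_right
    (hC.l1_moment_sub_recursion_le S hU hUc (by simp [w]) hw hq n) hC.K_nonneg)
  have e1 : S.R_BζΔ n i j = (S.moment n U ᵥ* E) i := by
    rw [hC.R_BζΔ_apply, S.moment_vecMul (hU.mono hle)]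
    exact integral_congr_ae (Filter.Eventually.of_forall fun ω => by simp only [U]; ring)
  have e2 : S.moment 0 U = fun k => S.R_ΔΔζ (-n) k j := by
    ext k
    rw [hC.moment_mul_Δ_eq S (hC.essBdd_ζ n)]
    have := S.integral_shift hC.measurable (-n) 0 n
      (Φ := fun p => p.1.2.2 k * p.1.2.2 j * p.2.2.1) (by fun_prop)
    simp only [StationarySolution.triple, neg_add_cancel, zero_add] at this
    rw [this, StationarySolution.R_ΔΔζ, of_apply]
  have e3 : (Eᵀ * (P 0)ᵀ ^ n * S.R_ΔΔζ (-n)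
      + Eᵀ * ∑ i ∈ Finset.range n, autoCorr μ ζ ((n : ℤ) - i) •
        ((P 0)ᵀ ^ (n - 1 - i) * Eᵀ * (P 0)ᵀ ^ i * Sig)) i j = (w n ᵥ* E) i := by
    rw [Matrix.mul_assoc, ← Matrix.mul_add, transpose_mul_apply_eq_vecMul]
    congr 2
    ext k
    simp only [w, Matrix.add_apply, Pi.add_apply, Matrix.sum_apply, Finset.sum_apply, e2, q]
    congr 1
    · rw [← transpose_pow, transpose_mul_apply_eq_vecMul]
    · refine Finset.sum_congr rfl fun m _ => ?_
      rw [Matrix.smul_apply, ← transpose_pow, ← transpose_pow, ← transpose_mul, Matrix.mul_assoc,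
        ← Matrix.mul_assoc, ← transpose_mul, smul_vecMul, Pi.smul_apply,
        transpose_mul_apply_eq_vecMul, Matrix.mul_assoc]
  rw [Matrix.sub_apply, e1, e3, ← Pi.sub_apply, ← sub_vecMul]
  calc _ ≤ _ := b
    _ = _ := by ring

/-- The weight `ζ_n² Δ_0` is already of order `ε²`: the first-order law from time zero to `n`,
followed by the unperturbed covariance at zero, suffices. -/
theorem entriesLE_R_VζζΔ_sub (n : ℕ) : EntriesLE
    (S.R_VζζΔ n - ((1 / 2 : ℝ) * ∫ ω, ζ 0 ω ^ 2 ∂μ) •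
      ((P 0 ^ n * W)ᵀ * sigmaBullet (P 0) π₀))
    ((κ * d * K + d * (2 * (κ * d * K) + 2 * K)) * K * ε ^ 3) := by
  intro i j
  have hle := S.history_le hC.measurable 0
  have hZ := hC.essBdd_ζ_sq n
  set U : Ω → ℝ := fun ω => ζ n ω ^ 2 * S.Δ 0 ω j
  have hU : EssBdd (S.history 0) μ U :=
    (hZ.mono (S.procSigma_le_history 0)).mul (S.essBdd_Δ hC.measurable le_rfl j)
  have hUc : ∀ᵐ ω ∂μ, |U ω| ≤ ε ^ 2 := by
    filter_upwards [hC.abs_ζ_sq_le n, hC.abs_Δ_le S 0 j] with ω h1 h2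
    rw [abs_mul, ← mul_one (ε ^ 2)]
    exact mul_le_mul h1 h2 (abs_nonneg _) (pow_nonneg hC.nonneg 2)
  have hvar : ∫ ω, ζ n ω ^ 2 ∂μ = ∫ ω, ζ 0 ω ^ 2 ∂μ := by
    simp only [pow_two, hC.integral_ζ_mul_ζ S, sub_self]
  have e1 : S.R_VζζΔ n i j = 1 / 2 * (S.moment n U ᵥ* W) i := by
    rw [hC.R_VζζΔ_apply, S.moment_vecMul (hU.mono hle), ← integral_const_mul]
    exact integral_congr_ae (Filter.Eventually.of_forall fun ω => by simp only [U]; ring)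
  set σ : Fin d → ℝ := fun k => sigmaBullet (P 0) π₀ k j
  have b1 := hC.l1_moment_sub_pow_le S hU hUc n
  have b2 := (l1_vecMul_le (Submonoid.pow_mem _ (hC.stochastic 0) n)).trans
    (hC.l1_moment_mul_Δ_sub_le S hZ (hC.abs_ζ_sq_le n) j)
  have b3 := (abs_vecMul_le hC.taylor.abs_W i).trans (mul_le_mul_of_nonneg_right
    ((l1_add_le _ _).trans (add_le_add b1 b2)) hC.K_nonneg)
  rw [hvar, sub_vecMul, sub_add_sub_cancel, sub_vecMul, vecMul_vecMul, smul_vecMul] at b3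
  rw [Matrix.sub_apply, e1, Matrix.smul_apply, transpose_mul_apply_eq_vecMul, smul_eq_mul, mul_assoc,
    ← mul_sub, abs_mul, abs_of_pos (by norm_num : (0 : ℝ) < 1 / 2)]
  refine (mul_le_of_le_one_left (abs_nonneg _) (by norm_num)).trans (b3.trans_eq ?_)
  ring

end SmallDisturbance

end

end PerturbedChain

/-! ### Assembly of the constants. -/

lemma PerturbedChain.EntriesLE.mono {d : ℕ} {M : Matrix (Fin d) (Fin d) ℝ} {a b x : ℝ}
    (h : PerturbedChain.EntriesLE M (a * x)) (hab : a ≤ b) (hx : 0 ≤ x) :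
    PerturbedChain.EntriesLE M (b * x) := fun i j =>
  (h i j).trans (mul_le_mul_of_nonneg_right hab hx)

theorem theorem2p4 {d : ℕ} (P : ℝ → Matrix (Fin d) (Fin d) ℝ)
    (hA1 : PerturbedChain.AssumptionA1 P)
    (π₀ : Fin d → ℝ) (hπ₀ : PerturbedChain.IsInvariantPmf (P 0) π₀)
    (E W A Sig₀ : Matrix (Fin d) (Fin d) ℝ)
    (hE : E = PerturbedChain.firstDeriv P) (hW : W = PerturbedChain.secondDeriv P)
    (hA : A = (P 0)ᵀ) (hSig₀ : Sig₀ = PerturbedChain.sigmaBullet (P 0) π₀) :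
    ∃ ε₀ > (0 : ℝ), ∃ C : ℝ,
      ∀ (Ω : Type*) [MeasurableSpace Ω] (μ : Measure Ω) [IsProbabilityMeasure μ]
        (𝒩 : Type*) [MeasurableSpace 𝒩],
      -- the stationary processes with disturbance `ζ = ε ζ¹`, where `0 < ε ≤ ε₀`
      (∀ ε ∈ Set.Ioc 0 ε₀, ∀ (ζ₁ ζ : ℤ → Ω → ℝ), PerturbedChain.AssumptionA2 μ ζ₁ →
        (ζ = fun t ω => ε * ζ₁ t ω) →
        ∀ S : PerturbedChain.StationarySolution P μ ζ 𝒩,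
        -- the cross-correlation of `D` and `ζ`
        (∀ (t : ℤ) (i : Fin d),
          |S.R_Dζ t i - (π₀ ᵥ* E) i * PerturbedChain.autoCorr μ ζ (t - 1)| ≤ C * ε ^ 3) ∧
        -- the decomposition of `R_D`
        (∀ t : ℤ, PerturbedChain.EntriesLE
          (S.R_D t - (S.R_Bζ t + S.R_Δ t
            + (S.R_BζΔ (t - 1) + (S.R_BζΔ (-t - 1))ᵀ)
            + (S.R_VζζΔ (t - 1) + (S.R_VζζΔ (-t - 1))ᵀ))) (C * ε ^ 3)) ∧
        -- (a)
        (∀ n : ℕ, PerturbedChain.EntriesLE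
          (S.R_Bζ n - PerturbedChain.autoCorr μ ζ n •
            (((P 0) ^ n * E)ᵀ * diagonal π₀ * E)) (C * ε ^ 3)) ∧
        -- (b)
        (∀ t : ℤ, t ≠ 0 → S.R_Δ t = 0) ∧
        PerturbedChain.EntriesLE
          (S.R_Δ 0 - (diagonal S.mean - (P 0)ᵀ * diagonal S.mean * P 0
            - ((P 0)ᵀ * diagonal (S.R_Γζ 0) * E + Eᵀ * diagonal (S.R_Γζ 0) * P 0)
            - ((1 / 2 : ℝ) * PerturbedChain.autoCorr μ ζ 0) •
              ((P 0)ᵀ * diagonal π₀ * W + (2 : ℝ) • (Eᵀ * diagonal π₀ * E)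
                + Wᵀ * diagonal π₀ * P 0))) (C * ε ^ 3) ∧
        -- (c)
        (∀ t : ℤ, t < 0 → S.R_BζΔ t = 0) ∧
        PerturbedChain.EntriesLE (S.R_BζΔ 0 - Eᵀ * S.R_ΔΔζ 0) (C * ε ^ 3) ∧
        (∀ n : ℕ, 1 ≤ n → PerturbedChain.EntriesLE
          (S.R_BζΔ n - (Eᵀ * A ^ n * S.R_ΔΔζ (-n)
            + Eᵀ * ∑ i ∈ Finset.range n, PerturbedChain.autoCorr μ ζ ((n : ℤ) - i) •
                (A ^ (n - 1 - i) * Eᵀ * A ^ i * Sig₀))) (C * ε ^ 3)) ∧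
        -- (d)
        (∀ t : ℤ, t < 0 → S.R_VζζΔ t = 0) ∧
        (∀ n : ℕ, PerturbedChain.EntriesLE
          (S.R_VζζΔ n - ((1 / 2 : ℝ) * ∫ ω, (ζ 0 ω) ^ 2 ∂μ) •
            (((P 0) ^ n * W)ᵀ * Sig₀)) (C * ε ^ 3))) ∧
      -- the unperturbed chain (`ζ ≡ 0`): its martingale-difference covariance is `Sig₀`
      (∀ S₀ : PerturbedChain.StationarySolution P μ (fun _ _ => (0 : ℝ)) 𝒩, S₀.R_Δ 0 = Sig₀) := by
  have hQ := hA1.stochastic 0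
  obtain ⟨κ, hκ⟩ := PerturbedChain.exists_responseBound hQ hA1.irreducible hA1.aperiodic
  obtain ⟨K, δ, hT⟩ := PerturbedChain.exists_taylorBound hA1
  rw [← hE, ← hW] at hT
  have hK : 0 ≤ K := zero_le_one.trans hT.one_le
  have hκ0 := hκ.nonneg
  subst hA hSig₀
  obtain ⟨c₁, hc₁⟩ : ∃ c, c = κ * d * K * K + K := ⟨_, rfl⟩
  obtain ⟨c₂, hc₂⟩ : ∃ c, c = 3 * K ^ 2 := ⟨_, rfl⟩
  obtain ⟨c₃, hc₃⟩ : ∃ c, c = 2 * (κ * d * K * K ^ 2) := ⟨_, rfl⟩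
  obtain ⟨c₄, hc₄⟩ : ∃ c, c = κ * d * K * (K + K ^ 2) + (2 * K + 3 * K ^ 2) := ⟨_, rfl⟩
  obtain ⟨c₅, hc₅⟩ : ∃ c, c = κ * (d * K + d * K * (κ * d * K)
    + d * K * (d * (2 * (κ * d * K) + 2 * K))) * K := ⟨_, rfl⟩
  obtain ⟨c₆, hc₆⟩ : ∃ c, c = (κ * d * K + d * (2 * (κ * d * K) + 2 * K)) * K := ⟨_, rfl⟩
  have h₁ : 0 ≤ c₁ := by rw [hc₁]; positivity
  have h₂ : 0 ≤ c₂ := by rw [hc₂]; positivity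
  have h₃ : 0 ≤ c₃ := by rw [hc₃]; positivity
  have h₄ : 0 ≤ c₄ := by rw [hc₄]; positivity
  have h₅ : 0 ≤ c₅ := by rw [hc₅]; positivity
  have h₆ : 0 ≤ c₆ := by rw [hc₆]; positivity
  -- `δ` is the radius of the Taylor bounds, and `ε ≤ 1` lets higher powers of `ε` be absorbed. The
  -- constants depend only on `d`, `κ` and `K`, hence on `P` alone.
  refine ⟨min δ 1, lt_min hT.pos one_pos, c₁ + c₂ + c₃ + c₄ + c₅ + c₆, ?_⟩
  intro Ω _ μ _ 𝒩 _
  refine ⟨?_, ?_⟩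
  · intro ε hε ζ₁ ζ hA2 hζ S
    have hC : PerturbedChain.SmallDisturbance P π₀ E W κ K δ ε μ ζ :=
      { E_eq := hE
        W_eq := hW
        stochastic := hA1.stochastic
        invariant := hπ₀
        response := hκ
        taylor := hT
        nonneg := hε.1.le
        le_one := hε.2.trans (min_le_right _ _)
        le_radius := hε.2.trans (min_le_left _ _)
        measurable := fun t => by
          rw [hζ]
          exact (hA2.measurable t).const_mul ε
        bounded := fun t => by
          filter_upwards [hA2.bounded t] with ω h
          rw [hζ, abs_mul, abs_of_pos hε.1]
          exact mul_le_of_le_one_right hε.1.le h }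
    have hε3 : 0 ≤ ε ^ 3 := pow_nonneg hε.1.le 3
    refine ⟨fun t i => ?_, fun t => ?_, fun n => ?_, fun t ht => hC.R_Δ_eq_zero S ht, ?_,
      fun t ht => hC.R_BζΔ_eq_zero S ht, fun i j => ?_, fun n _ => ?_,
      fun t ht => hC.R_VζζΔ_eq_zero S ht, fun n => ?_⟩
    · refine (hC.abs_R_Dζ_sub_le S t i).trans (mul_le_mul_of_nonneg_right ?_ hε3)
      linarith
    · exact (hC.entriesLE_R_D_sub S t).mono (by linarith) hε3
    · exact (hC.entriesLE_R_Bζ_sub S n).mono (by linarith) hε3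
    · exact (hC.entriesLE_R_Δ_zero_sub S).mono (by linarith) hε3
    · rw [hC.R_BζΔ_zero S, sub_self, Matrix.zero_apply, abs_zero]
      positivity
    · exact (hC.entriesLE_R_BζΔ_sub S n).mono (by linarith) hε3
    · exact (hC.entriesLE_R_VζζΔ_sub S n).mono (by linarith) hε3
  · intro S₀
    -- Amplitude `ε = 0` is admissible, and the `O(ε)` error in the innovation covariance is then
    -- exactly zero.
    have hC : PerturbedChain.SmallDisturbance P π₀ E W κ K δ 0 μ (fun (_ : ℤ) (_ : Ω) => (0 : ℝ)) :=
      { E_eq := hE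
        W_eq := hW
        stochastic := hA1.stochastic
        invariant := hπ₀
        response := hκ
        taylor := hT
        nonneg := le_rfl
        le_one := zero_le_one
        le_radius := hT.pos.le
        measurable := fun _ => measurable_const
        bounded := fun _ => Filter.Eventually.of_forall fun _ => by simp }
    ext i j
    have h := hC.abs_integral_Δ_mul_Δ_sub_le S₀ (Z := fun _ => 1)
      (PerturbedChain.EssBdd.const 1) (c := 1) (Filter.Eventually.of_forall fun _ => by simp) 0 i j
    simp only [one_mul, mul_zero, integral_const, probReal_univ, smul_eq_mul] at h
    exact sub_eq_zero.1 (abs_nonpos_iff.1 h)
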